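/- **Setting.** Let $X\in\mathbb R^{n\times p}$ have rank $r$ and columns $X_1,\dots,X_p$, let $\beta^0\in\mathbb R^p$, $\sigma>0$ and $Y\sim\mathcal N_n(X\beta^0,\sigma^2\mathrm{Id}_n)$. Fix $1\le K<\min(n-3,r)$ and $n_1,n_2\ge 0$ with $n=n_1+n_2+K+1$. Put $Z=(X^\top Y,-X^\top Y)\in\mathbb R^{2p}$ and $R=\begin{pmatrix}X^\top X&-X^\top X\\-X^\top X&X^\top X\end{pmatrix}$; a signed variable $i\in[2p]$ encodes the variable $j\in[p]$ with sign $+1$ if $i=j$ and sign $-1$ if $i=j+p$. For signed variables $i_1,\dots,i_k$ let $M=(R_{i_u,i_v})_{u,v\le k}$, $$\theta_j(i_1,\dots,i_k)=(R_{j,i_1}\cdots R_{j,i_k})M^{-1}(1,\dots,1)^\top,\qquad Z_j^{(i_1,\dots,i_k)}=\frac{Z_j-(R_{j,i_1}\cdots R_{j,i_k})M^{-1}(Z_{i_1},\dots,Z_{i_k})^\top}{1-\theta_j(i_1,\dots,i_k)} .$$ The LAR knots and signed variables are, for $k\ge1$, $\lambda_k=\max\{Z_j^{(\hat\imath_1,\dots,\hat\imath_{k-1})}:\theta_j(\hat\imath_1,\dots,\hat\imath_{k-1})<1\}$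 and $\hat\imath_k$ the corresponding arg max (the smallest one in case of a tie); $\lambda_0=\infty$. $H_k$ is the span of the $k$ columns of $X$ indexed by $\hat\imath_1,\dots,\hat\imath_k$ (signs dropped), $H_0=\{0\}$. A sequence $(i_1,\dots,i_K)$ satisfies the *Irrepresentable Check* if its underlying variables are pairwise different and $\theta_j(i_1,\dots,i_k)<1$ for all $k\in[K]$ and all $j\in[2p]\setminus\{i_1,\dots,i_k\}$. $\hat\sigma_{\rm select}=\|P_{E_1}Y\|_2/\sqrt{n_1}$, where $E_1$ is the space of dimension $n_1$ of the form $P^\perp_{K+1}(\mathrm{Span}(e_1,\dots,e_\ell))$, with $P_{K+1}^\perp$ the orthogonal projector onto $H_{K+1}^\perp$. A *stopping rule* is $\hat m\in\{0,\dots,K-1\}$ such that, for each $a\in\{0,\dots,K-1\}$, $\mathbf 1_{\{\hat m\le a\}}$ is a measurable function of $(\lambda_1,\dots,\lambda_a,\hat\imath_1,\dots,\hat\imath_{K+1},\hat\sigma_{\rm select})$. Let $\rho_k=\dfrac{\sqrt{R_{\hat\imath_k,\hat\imath_k}-(R_{\hat\imath_k,\hat\imath_1}\cdots R_{\hat\imath_k,\hat\imath_{k-1}})M^{-1}(R_{\hat\imath_k,\hat\imath_1},\dots,R_{\hat\imath_k,\hat\imath_{k-1}})^\top}}{1-\theta_{\hat\imath_k}(\hat\imath_1,\dots,\hat\imath_{k-1})}$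 with $M$ indexed by $\hat\imath_1,\dots,\hat\imath_{k-1}$, let $\Phi_k$ be the CDF of $\mathcal N(0,\sigma^2\rho_k^2)$, $\mathcal P_{i,j}=\Phi_i\circ\Phi_j^{-1}$, $F_k=\Phi_k(\lambda_k)$, with the conventions $F_0=1$ and $\mathcal P_{i,0}(1)=1$. For $a<b$ put $$\mathcal I_{ab}(s,t)=\int_{\mathcal P_{a+1,b}(t)}^{\mathcal P_{a+1,a}(s)}df_{a+1}\int_{\mathcal P_{a+2,b}(t)}^{\mathcal P_{a+2,a+1}(f_{a+1})}df_{a+2}\cdots\int_{\mathcal P_{b-1,b}(t)}^{\mathcal P_{b-1,b-2}(f_{b-2})}df_{b-1},\qquad \mathcal I_{a,a+1}=1,$$ $$\mathbb F_{abc}(t)=\mathbf 1_{\{\lambda_c\le t\le\lambda_a\}}\int_{\Phi_b(\lambda_c)}^{\Phi_b(t)}\mathcal I_{ab}(F_a,f_b)\,\mathcal I_{bc}(f_b,F_c)\,df_b .$$ **Proposition.** Let $0\le a<b<c\le K+1$ and let $\hat m$ be a stopping rule. Let $(i_1,\dots,i_a)\in[2p]^a$ be such that, on $\{\hat\imath_1=i_1,\dots,\hat\imath_a=i_a\}$,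 the null hypothesis $\mathbb H_0: X\beta^0\in H_a$ holds. Work under the conditional probability given the selection event that $\hat m=a$, $(\hat\imath_1,\dots,\hat\imath_a)=(i_1,\dots,i_a)$ and $(\hat\imath_1,\dots,\hat\imath_K)$ satisfies the Irrepresentable Check. Then almost surely $\mathbb F_{abc}(\lambda_a)>0$, and for every $t\in\mathbb R$, almost surely, $$\mathbb P\big[\lambda_b\le t\,\big|\,\hat m=a,\lambda_a,\lambda_c,\hat\imath_{a+1},\dots,\hat\imath_{c-1}\big]=\frac{\mathbb F_{abc}(t)}{\mathbb F_{abc}(\lambda_a)}\quad\text{if }t\le\lambda_a,$$ and this conditional probability equals $1$ if $t>\lambda_a$. The same holds when one conditions in addition on $\hat\imath_c,\dots,\hat\imath_d$, for any $c\le d\le K+1$. -/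

import Mathlib

open MeasureTheory ProbabilityTheory Matrix

namespace LAR

noncomputable section

/-! Signed variables are elements of `Fin (p + p)`: the first block is a variable of `Fin p` with
sign `+1`, the second block is the same variable with sign `-1`. -/

/-- The unsigned variable underlying a signed variable. -/
def unsigned {p : ℕ} (i : Fin (p + p)) : Fin p := Fin.addCases id id i

/-- The `j`-th column of the design, as a vector of the Euclidean space of observations. -/
def column {n p : ℕ} (X : Matrix (Fin n) (Fin p) ℝ) (j : Fin p) : EuclideanSpace ℝ (Fin n) :=
  WithLp.toLp 2 (fun m => X m j)

/-- The vector `Z = (Xᵀ y, -Xᵀ y)`. -/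
def corr {n p : ℕ} (X : Matrix (Fin n) (Fin p) ℝ) (y : EuclideanSpace ℝ (Fin n)) :
    Fin (p + p) → ℝ :=
  Fin.append (Xᵀ *ᵥ y.ofLp) (-(Xᵀ *ᵥ y.ofLp))

/-- The matrix `R`, with blocks `XᵀX, -XᵀX, -XᵀX, XᵀX`. -/
def gram {n p : ℕ} (X : Matrix (Fin n) (Fin p) ℝ) : Matrix (Fin (p + p)) (Fin (p + p)) ℝ :=
  (Matrix.fromBlocks (Xᵀ * X) (-(Xᵀ * X)) (-(Xᵀ * X)) (Xᵀ * X)).reindex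
    finSumFinEquiv finSumFinEquiv

/-- `(R_{j,i₁}, …, R_{j,i_k}) M⁻¹ v`, where `M` is the submatrix of `R` indexed by `i₁, …, i_k`. -/
def regress {n p k : ℕ} (X : Matrix (Fin n) (Fin p) ℝ) (i : Fin k → Fin (p + p))
    (j : Fin (p + p)) (v : Fin k → ℝ) : ℝ :=
  (fun l => gram X j (i l)) ⬝ᵥ (((gram X).submatrix i i)⁻¹ *ᵥ v)

/-- `θ_j(i₁, …, i_k)`. -/
def theta {n p k : ℕ} (X : Matrix (Fin n) (Fin p) ℝ) (i : Fin k → Fin (p + p))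
    (j : Fin (p + p)) : ℝ :=
  regress X i j (fun _ => 1)

/-- `Z_j^{(i₁, …, i_k)} = (Z_j - Π_{i₁, …, i_k}(Z_j)) / (1 - θ_j(i₁, …, i_k))`. -/
def frozenZ {n p k : ℕ} (X : Matrix (Fin n) (Fin p) ℝ) (y : EuclideanSpace ℝ (Fin n))
    (i : Fin k → Fin (p + p)) (j : Fin (p + p)) : ℝ :=
  (corr X y j - regress X i j (fun l => corr X y (i l))) / (1 - theta X i j)

/-- The knot that follows the signed variables `i₁, …, i_k`: the maximum of
`Z_j^{(i₁, …, i_k)}` over the signed variables `j` with `θ_j(i₁, …, i_k) < 1`. -/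
def nextKnot {n p k : ℕ} (X : Matrix (Fin n) (Fin p) ℝ) (y : EuclideanSpace ℝ (Fin n))
    (i : Fin k → Fin (p + p)) : ℝ :=
  ⨆ j : {j : Fin (p + p) // theta X i j < 1}, frozenZ X y i j

open scoped Classical in
/-- The signed variables at which that maximum is attained. -/
def maximizers {n p k : ℕ} (X : Matrix (Fin n) (Fin p) ℝ) (y : EuclideanSpace ℝ (Fin n))
    (i : Fin k → Fin (p + p)) : Finset (Fin (p + p)) :=
  {j | theta X i j < 1 ∧ ∀ l, theta X i l < 1 → frozenZ X y i l ≤ frozenZ X y i j}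

open scoped Classical in
/-- The signed variable that enters after `i₁, …, i_k`: the arg max (the smallest one in case of
a tie; the value in the `else` branch is never used, the set of maximizers being non-empty). -/
def nextIndex {n p k : ℕ} [NeZero p] (X : Matrix (Fin n) (Fin p) ℝ)
    (y : EuclideanSpace ℝ (Fin n)) (i : Fin k → Fin (p + p)) : Fin (p + p) :=
  if h : (maximizers X y i).Nonempty then (maximizers X y i).min' h else Fin.castAdd p 0

/-- The first `k` signed variables `(î₁, …, î_k)` entering along the LAR path. -/
def larPath {n p : ℕ} [NeZero p] (X : Matrix (Fin n) (Fin p) ℝ)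
    (y : EuclideanSpace ℝ (Fin n)) : (k : ℕ) → Fin k → Fin (p + p)
  | 0 => Fin.elim0
  | k + 1 => Fin.snoc (α := fun _ => Fin (p + p)) (larPath X y k) (nextIndex X y (larPath X y k))

/-- The `k`-th signed variable `î_k` entering along the LAR path, for `k ≥ 1`. -/
def larIndex {n p : ℕ} [NeZero p] (X : Matrix (Fin n) (Fin p) ℝ)
    (y : EuclideanSpace ℝ (Fin n)) (k : ℕ) : Fin (p + p) :=
  nextIndex X y (larPath X y (k - 1))

/-- The LAR knots `λ₁, λ₂, …`, with the convention `λ₀ = ∞`. -/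
def larKnot {n p : ℕ} [NeZero p] (X : Matrix (Fin n) (Fin p) ℝ)
    (y : EuclideanSpace ℝ (Fin n)) : ℕ → EReal
  | 0 => ⊤
  | k + 1 => ((nextKnot X y (larPath X y k) : ℝ) : EReal)

/-- `ρ_k` for `k ≥ 1`: the standard deviation of the `k`-th frozen knot along the LAR path, divided
by `σ`. The value at `0` is a convention: all that is used of `Φ₀` is that `Φ₀(∞) = 1` and
`Φ₀⁻¹(1) = ∞`. -/
def larRho {n p : ℕ} [NeZero p] (X : Matrix (Fin n) (Fin p) ℝ)
    (y : EuclideanSpace ℝ (Fin n)) : ℕ → ℝ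
  | 0 => 1
  | k + 1 =>
    Real.sqrt (gram X (larIndex X y (k + 1)) (larIndex X y (k + 1)) -
        regress X (larPath X y k) (larIndex X y (k + 1))
          (fun l => gram X (larIndex X y (k + 1)) (larPath X y k l))) /
      (1 - theta X (larPath X y k) (larIndex X y (k + 1)))

/-- The Irrepresentable Check for `(i₁, …, i_K)`: the underlying unsigned variables are pairwise
different, and `θ_j(i₁, …, i_k) < 1` for all `1 ≤ k ≤ K` and all signed `j ∉ {i₁, …, i_k}`. -/
def IrrepresentableCheck {n p K : ℕ} (X : Matrix (Fin n) (Fin p) ℝ)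
    (i : Fin K → Fin (p + p)) : Prop :=
  Function.Injective (fun l => unsigned (i l)) ∧
    ∀ (k : ℕ) (hk : k ≤ K), 1 ≤ k → ∀ j : Fin (p + p),
      (∀ l : Fin k, j ≠ i (Fin.castLE hk l)) → theta X (fun l => i (Fin.castLE hk l)) j < 1

/-- The span of the columns of the design selected by `i₁, …, i_k`. -/
def selectedSpan {n p k : ℕ} (X : Matrix (Fin n) (Fin p) ℝ) (i : Fin k → Fin (p + p)) :
    Submodule ℝ (EuclideanSpace ℝ (Fin n)) :=
  Submodule.span ℝ (Set.range fun l => column X (unsigned (i l)))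

/-- The image of `Span(e₁, …, e_ℓ)` under the orthogonal projection onto the orthogonal complement
of the span of the selected columns. -/
def projectedCoords {n p k : ℕ} (X : Matrix (Fin n) (Fin p) ℝ) (i : Fin k → Fin (p + p))
    (l : ℕ) : Submodule ℝ (EuclideanSpace ℝ (Fin n)) :=
  (Submodule.span ℝ ((fun m : Fin n => EuclideanSpace.single m (1 : ℝ)) '' {m | (m : ℕ) < l})).map
    ((selectedSpan X i)ᗮ.starProjection : EuclideanSpace ℝ (Fin n) →ₗ[ℝ] EuclideanSpace ℝ (Fin n))

/-- The space `E₁`: the member of dimension `n₁` of the nested family `projectedCoords`. -/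
def selectSpace {n p k : ℕ} (X : Matrix (Fin n) (Fin p) ℝ) (i : Fin k → Fin (p + p))
    (n₁ : ℕ) : Submodule ℝ (EuclideanSpace ℝ (Fin n)) :=
  projectedCoords X i (sInf {l : ℕ | Module.finrank ℝ (projectedCoords X i l) = n₁})

/-- The estimate `σ̂_select = ‖P_{E₁} y‖ / √n₁` built on the selected variables `î₁, …, î_{K+1}`. -/
def sigmaSelect {n p : ℕ} [NeZero p] (X : Matrix (Fin n) (Fin p) ℝ) (K n₁ : ℕ)
    (y : EuclideanSpace ℝ (Fin n)) : ℝ :=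
  ‖(selectSpace X (larPath X y (K + 1)) n₁).starProjection y‖ / Real.sqrt n₁

/-- The stopping rule: `m̂` takes values in `{0, …, K - 1}` and, for each `a` in this set, the
event `{m̂ ≤ a}` is measurable with respect to
`(λ₁, …, λ_a, î₁, …, î_{K+1}, σ̂_select)`. -/
def IsStoppingRule {Ω : Type*} {n p : ℕ} [NeZero p] (X : Matrix (Fin n) (Fin p) ℝ) (K n₁ : ℕ)
    (Y : Ω → EuclideanSpace ℝ (Fin n)) (mhat : Ω → ℕ) : Prop :=
  (∀ ω, mhat ω < K) ∧
    ∀ a < K, MeasurableSet[MeasurableSpace.comap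
      (fun ω => ((fun l : Fin a => larKnot X (Y ω) (l + 1)), larPath X (Y ω) (K + 1),
        sigmaSelect X K n₁ (Y ω))) inferInstance] {ω | mhat ω ≤ a}

/-- The σ-algebra generated by `λ_a, λ_c, î_{a+1}, …, î_d`. -/
abbrev knotSigma {Ω : Type*} {n p : ℕ} [NeZero p] (X : Matrix (Fin n) (Fin p) ℝ)
    (Y : Ω → EuclideanSpace ℝ (Fin n)) (a c d : ℕ) : MeasurableSpace Ω :=
  MeasurableSpace.comap
    (fun ω => (larKnot X (Y ω) a, larKnot X (Y ω) c,
      fun l : Finset.Ioc a d => larIndex X (Y ω) l)) inferInstance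

/-- `Φ_k`, the CDF of the centered Gaussian law with standard deviation `σ ρ_k`, extended to the
extended real line by `Φ_k(-∞) = 0` and `Φ_k(∞) = 1`. -/
def PhiK (σ : ℝ) (ρ : ℕ → ℝ) (k : ℕ) (x : EReal) : ℝ :=
  (gaussianReal 0 ((σ * ρ k) ^ 2).toNNReal).real {y : ℝ | (y : EReal) ≤ x}

/-- `Φ_k⁻¹`, the inverse of `Φ_k` on `[0, 1]`. -/
def PhiKInv (σ : ℝ) (ρ : ℕ → ℝ) (k : ℕ) (f : ℝ) : EReal :=
  sInf {x : EReal | f ≤ PhiK σ ρ k x}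

/-- `P_{i,j} = Φ_i ∘ Φ_j⁻¹`. -/
def calP (σ : ℝ) (ρ : ℕ → ℝ) (i j : ℕ) (f : ℝ) : ℝ :=
  PhiK σ ρ i (PhiKInv σ ρ j f)

/-- The iterated integral of `1` over `f_{a+1}, …, f_{a+g}`, in this order from the outside to the
inside, where `f_k` runs from `P_{k,b}(t)` to `P_{k,k-1}(f_{k-1})` and `f_a = s`. -/
def iterI (σ : ℝ) (ρ : ℕ → ℝ) (b : ℕ) (t : ℝ) : (g a : ℕ) → (s : ℝ) → ℝ
  | 0, _, _ => 1
  | g + 1, a, s =>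
    ∫ f in (calP σ ρ (a + 1) b t)..(calP σ ρ (a + 1) a s), iterI σ ρ b t g (a + 1) f

/-- `I_{ab}(s, t)` for `a < b`; it equals `1` when `b = a + 1`. -/
def calI (σ : ℝ) (ρ : ℕ → ℝ) (a b : ℕ) (s t : ℝ) : ℝ :=
  iterI σ ρ b t (b - a - 1) a s

open scoped Classical in
/-- `F_{abc}(t)`, as a function of `σ`, the `ρ_k` and the values `la` and `lc` of the knots
`λ_a` and `λ_c`. -/
def Fabc (σ : ℝ) (ρ : ℕ → ℝ) (a b c : ℕ) (la lc t : EReal) : ℝ :=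
  if lc ≤ t ∧ t ≤ la then
    ∫ f in (PhiK σ ρ b lc)..(PhiK σ ρ b t),
      calI σ ρ a b (PhiK σ ρ a la) f * calI σ ρ b c f (PhiK σ ρ c lc)
  else 0

end

end LAR

namespace LAR

noncomputable section

/-! Fix the first `K` signed variables `q`, assumed to pass the Irrepresentable Check with
independent columns. Along `q`, the knot of index `k + 1 ≤ K` is the linear form `⟪direction X q k,
y⟫`, where `direction X q k` is the part of the signed column `q k` orthogonal to the earlier ones,
divided by `1 - θ`. These directions are orthogonal to each other, with norm `ρ_{k+1}`. The knot of
index `K + 1` and the variable that enters then depend only on the component of `y` orthogonal to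
`H_K`.

The geometric core is `Regular.larPath_eq_iff`: for almost every `y`, the algorithm follows `q`
exactly when the knots computed along `q` are non-increasing. It rests on
`Independent.frozenZ_snocVar_cmp`: when a variable enters, a competitor stays on the same side of
the current knot before and after.

The probabilistic core is `Regular.setLIntegral_ratio`. Let `outerProj` remove the directions
carrying `λ_{a+1}, …, λ_{c-1}`. It leaves unchanged `λ₁, …, λ_a`, the knots from `λ_c` to `λ_{K+1}`,
the variable entering at step `K + 1` and `σ̂_select`, hence everything the stopping rule and the
conditioning look at. By orthogonality the removed coordinates are independent of the projection and
of each other, and `X β₀ ∈ H_a` makes them centered. Given the rest, the removed knots therefore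
follow a product of laws `N(0, σ²ρ_k²)` restricted to sequences decreasing from `λ_a` to `λ_c`, and
the conditional distribution function of `λ_b` is a ratio of two masses `chainMass`. This ratio
depends only on the conditioning data, so summing over the finitely many paths gives
`setLIntegral_dataRatio`.

Finally the substitutions `f_k = Φ_k(λ_k)` identify those masses with the iterated integrals
(`Fabc_eq_chainMass`). -/

open scoped ENNReal RealInnerProductSpace

/-! ### Distribution functions and the substitution `f = Φ(x)` -/

/-- The distribution function of a measure on the line, on the extended real line. -/
def ecdf (γ : Measure ℝ) (x : EReal) : ℝ := γ.real {y : ℝ | (y : EReal) ≤ x}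

lemma ecdf_mono (γ : Measure ℝ) [IsFiniteMeasure γ] : Monotone (ecdf γ) := fun _ _ h =>
  measureReal_mono fun _ hy => le_trans hy h

lemma ecdf_coe (γ : Measure ℝ) (x : ℝ) : ecdf γ x = γ.real (Set.Iic x) := by
  simp [ecdf, Set.Iic]

lemma ecdf_nonneg (γ : Measure ℝ) (x : EReal) : 0 ≤ ecdf γ x := measureReal_nonneg

lemma ecdf_le_one (γ : Measure ℝ) [IsProbabilityMeasure γ] (x : EReal) : ecdf γ x ≤ 1 :=
  measureReal_le_one

lemma ecdf_strictMono (γ : Measure ℝ) [IsFiniteMeasure γ] [γ.IsOpenPosMeasure] :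
    StrictMono (ecdf γ) := by
  intro x y hxy
  obtain ⟨u, hxu, huy⟩ := EReal.lt_iff_exists_real_btwn.1 hxy
  obtain ⟨v, huv, hvy⟩ := EReal.lt_iff_exists_real_btwn.1 huy
  have huv' : u < v := EReal.coe_lt_coe_iff.1 huv
  have hpos : 0 < γ (Set.Ioo u v) := isOpen_Ioo.measure_pos γ (Set.nonempty_Ioo.2 huv')
  have hpos' : 0 < γ.real (Set.Ioo u v) := ENNReal.toReal_pos hpos.ne' (measure_ne_top _ _)
  have hdisj : Disjoint {w : ℝ | (w : EReal) ≤ x} (Set.Ioo u v) := by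
    rw [Set.disjoint_left]
    intro w hw hw'
    exact absurd (EReal.coe_lt_coe_iff.1 ((show (w : EReal) ≤ x from hw).trans_lt hxu)) (not_lt.2 hw'.1.le)
  have h := measureReal_union (μ := γ) hdisj measurableSet_Ioo
  have h2 : γ.real ({w : ℝ | (w : EReal) ≤ x} ∪ Set.Ioo u v) ≤ ecdf γ y := by
    refine measureReal_mono ?_
    rintro w (hw | hw)
    · exact le_trans hw hxy.le
    · exact ((EReal.coe_lt_coe_iff.2 hw.2).trans hvy).le
  have h3 : γ.real {w : ℝ | (w : EReal) ≤ x} = ecdf γ x := rfl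
  linarith

/-- The jump at a point is the mass of that point, which is zero for an atomless law. -/
lemma ecdf_continuous_coe (γ : Measure ℝ) [IsProbabilityMeasure γ] [NullSingletonClass γ] :
    Continuous fun x : ℝ => ecdf γ x := by
  have h : (fun x : ℝ => ecdf γ x) = cdf γ := by
    ext x; rw [ecdf_coe, cdf_eq_real]
  rw [h, continuous_iff_continuousAt]
  intro x
  rw [(monotone_cdf γ).continuousAt_iff_leftLim_eq_rightLim]
  have h1 : (cdf γ).measure {x} = 0 := by rw [measure_cdf]; exact measure_singleton x
  rw [StieltjesFunction.measure_singleton, ENNReal.ofReal_eq_zero] at h1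
  have h2 := (monotone_cdf γ).leftLim_le (le_refl x)
  have h3 := StieltjesFunction.rightLim_eq (cdf γ) x
  rw [h3]
  linarith

lemma ecdf_measurable (γ : Measure ℝ) [IsFiniteMeasure γ] :
    Measurable fun x : ℝ => ecdf γ x :=
  Monotone.measurable fun _ _ h => ecdf_mono γ (EReal.coe_le_coe_iff.2 h)

/-- Probability integral transform: for a continuous and strictly increasing `Φ`, the event `Φ(x) ≤
u` with `0 < u < 1` is a half-line `x ≤ Φ⁻¹(u)`, of mass `u`. -/
lemma map_ecdf (γ : Measure ℝ) [IsProbabilityMeasure γ] [NullSingletonClass γ] [γ.IsOpenPosMeasure] :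
    γ.map (fun x : ℝ => ecdf γ x) = volume.restrict (Set.Ioc 0 1) := by
  have : IsProbabilityMeasure (γ.map (fun x : ℝ => ecdf γ x)) :=
    Measure.isProbabilityMeasure_map (ecdf_measurable γ).aemeasurable
  refine Measure.ext_of_Iic _ _ fun u => ?_
  rw [Measure.map_apply (ecdf_measurable γ) measurableSet_Iic, Measure.restrict_apply measurableSet_Iic]
  have hIic : Set.Iic u ∩ Set.Ioc (0 : ℝ) 1 = Set.Ioc 0 (min u 1) := by
    ext w; simp; grind
  rw [hIic, Real.volume_Ioc, sub_zero]
  rcases le_or_gt u 0 with hu | hu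
  · have : (fun x : ℝ => ecdf γ x) ⁻¹' Set.Iic u = ∅ := by
      ext x
      simp only [Set.mem_preimage, Set.mem_Iic, Set.mem_empty_iff_false, iff_false, not_le]
      exact hu.trans_lt ((ecdf_nonneg γ ⊥).trans_lt (ecdf_strictMono γ (EReal.bot_lt_coe x)))
    rw [this, measure_empty, eq_comm, ENNReal.ofReal_eq_zero]
    exact (min_le_left _ _).trans hu
  rcases le_or_gt 1 u with hu1 | hu1
  · have : (fun x : ℝ => ecdf γ x) ⁻¹' Set.Iic u = Set.univ := by
      ext x
      simpa using (ecdf_le_one γ x).trans hu1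
    rw [this, measure_univ, min_eq_right hu1, ENNReal.ofReal_one]
  · have hbot : Filter.Tendsto (fun x : ℝ => ecdf γ x) Filter.atBot (nhds 0) := by
      simpa only [ecdf_coe, ← cdf_eq_real] using tendsto_cdf_atBot γ
    have htop : Filter.Tendsto (fun x : ℝ => ecdf γ x) Filter.atTop (nhds 1) := by
      simpa only [ecdf_coe, ← cdf_eq_real] using tendsto_cdf_atTop γ
    obtain ⟨x, hx⟩ : ∃ x : ℝ, ecdf γ x = u :=
      mem_range_of_exists_le_of_exists_ge (ecdf_continuous_coe γ)
        ((hbot.eventually (gt_mem_nhds hu)).exists.imp fun _ h => h.le)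
        ((htop.eventually (lt_mem_nhds hu1)).exists.imp fun _ h => h.le)
    have : (fun x : ℝ => ecdf γ x) ⁻¹' Set.Iic u = Set.Iic x := by
      ext w
      simp only [Set.mem_preimage, Set.mem_Iic, ← hx, (ecdf_strictMono γ).le_iff_le,
        EReal.coe_le_coe_iff]
    rw [this, min_eq_left hu1.le, ← hx, ecdf_coe, ofReal_measureReal]

/-- Change of variables `f = Φ(x)` in an interval integral between two values of `Φ`. -/
lemma intervalIntegral_ecdf (γ : Measure ℝ) [IsProbabilityMeasure γ] [NullSingletonClass γ]
    [γ.IsOpenPosMeasure] {u v : EReal} (huv : u ≤ v) (h : ℝ → ℝ) (H : ℝ → ℝ≥0∞)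
    (hH : Measurable H) (hH1 : ∀ x, H x ≤ 1)
    (hh : ∀ x : ℝ, u < x → (x : EReal) ≤ v → h (ecdf γ x) = (H x).toReal) :
    ∫ f in (ecdf γ u)..(ecdf γ v), h f
      = (∫⁻ x in {x : ℝ | u ≤ x ∧ (x : EReal) ≤ v}, H x ∂γ).toReal := by
  have hme : MeasurableEmbedding (fun x : ℝ => ecdf γ x) :=
    (ecdf_continuous_coe γ).measurableEmbedding
      fun x y hxy => EReal.coe_injective ((ecdf_strictMono γ).injective hxy)
  rw [intervalIntegral.integral_of_le (ecdf_mono γ huv)]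
  have h1 : volume.restrict (Set.Ioc (ecdf γ u) (ecdf γ v))
      = (γ.map (fun x : ℝ => ecdf γ x)).restrict (Set.Ioc (ecdf γ u) (ecdf γ v)) := by
    rw [map_ecdf, Measure.restrict_restrict measurableSet_Ioc, Set.inter_eq_left.2]
    exact Set.Ioc_subset_Ioc (ecdf_nonneg _ _) (ecdf_le_one _ _)
  rw [h1, hme.setIntegral_map]
  have hset : (fun x : ℝ => ecdf γ x) ⁻¹' Set.Ioc (ecdf γ u) (ecdf γ v)
      = {x : ℝ | u < x ∧ (x : EReal) ≤ v} := by
    ext x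
    simp [(ecdf_strictMono γ).lt_iff_lt, (ecdf_strictMono γ).le_iff_le]
  have hm : MeasurableSet {x : ℝ | u < x ∧ (x : EReal) ≤ v} := by
    rw [← hset]; exact ecdf_measurable γ measurableSet_Ioc
  have hae : ({x : ℝ | u ≤ x ∧ (x : EReal) ≤ v} : Set ℝ) =ᵐ[γ] {x : ℝ | u < x ∧ (x : EReal) ≤ v} := by
    -- The two ranges differ at most at the point `u`. If `u` is infinite, `u.toReal` is the junk
    -- value `0`; discarding that point too is harmless.
    have : ∀ᵐ x ∂γ, x ≠ u.toReal := by
      rw [ae_iff]; simp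
    filter_upwards [this] with x hx
    refine propext ⟨fun ⟨h1, h2⟩ => ⟨lt_of_le_of_ne h1 ?_, h2⟩, fun ⟨h1, h2⟩ => ⟨h1.le, h2⟩⟩
    rintro rfl
    exact hx (EReal.toReal_coe x).symm
  rw [hset, setIntegral_congr_fun hm (fun x hx => hh x hx.1 hx.2), setLIntegral_congr hae,
    integral_toReal hH.aemeasurable]
  exact Filter.Eventually.of_forall fun x => (hH1 x).trans_lt ENNReal.one_lt_top

/-! ### Masses of decreasing sequences -/

/-- The mass, under the product of `γ (a + 1), …, γ (a + g)`, of the sequences which decrease from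
`la` to `lc` and whose `k`-th term is at most `τ k`. -/
def chainMass (γ : ℕ → Measure ℝ) (τ : ℕ → EReal) (lc : EReal) : ℕ → ℕ → EReal → ℝ≥0∞
  | 0, _, _ => 1
  | g + 1, a, la =>
    ∫⁻ y in {y : ℝ | lc ≤ y ∧ (y : EReal) ≤ la ∧ (y : EReal) ≤ τ (a + 1)},
      chainMass γ τ lc g (a + 1) y ∂(γ (a + 1))

/-- Measurability is needed jointly in both end points: when a sequence is cut at an intermediate
term, this term is the lower end of one piece and the upper end of the other. Writing the range of
integration as an indicator reduces it to measurability of partial integrals. -/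
lemma measurable_chainMass (γ : ℕ → Measure ℝ) [∀ k, IsProbabilityMeasure (γ k)]
    (τ : ℕ → EReal) (g a : ℕ) :
    Measurable fun z : EReal × EReal => chainMass γ τ z.1 g a z.2 := by
  induction g generalizing a with
  | zero => exact measurable_const
  | succ g ih =>
    have h : ∀ z : EReal × EReal, chainMass γ τ z.1 (g + 1) a z.2
        = ∫⁻ y : ℝ, ({w : (EReal × EReal) × ℝ | w.1.1 ≤ w.2 ∧ (w.2 : EReal) ≤ w.1.2 ∧
          (w.2 : EReal) ≤ τ (a + 1)}.indicator
            (fun w => chainMass γ τ w.1.1 g (a + 1) w.2)) (z, y) ∂(γ (a + 1)) := by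
      intro z
      rw [chainMass, ← lintegral_indicator]
      · rfl
      · exact ((measurableSet_le measurable_const measurable_coe_real_ereal).inter
          ((measurableSet_le measurable_coe_real_ereal measurable_const).inter
          (measurableSet_le measurable_coe_real_ereal measurable_const)))
    simp_rw [h]
    refine Measurable.lintegral_prod_right' (Measurable.indicator ?_ ?_)
    · exact (ih (a + 1)).comp (measurable_fst.fst.prodMk measurable_snd.coe_real_ereal)
    · exact ((measurableSet_le measurable_fst.fst measurable_snd.coe_real_ereal).inter
          ((measurableSet_le measurable_snd.coe_real_ereal measurable_fst.snd).inter
          (measurableSet_le measurable_snd.coe_real_ereal measurable_const)))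

lemma chainMass_le_one (γ : ℕ → Measure ℝ) [∀ k, IsProbabilityMeasure (γ k)]
    (τ : ℕ → EReal) (lc : EReal) (g a : ℕ) (la : EReal) : chainMass γ τ lc g a la ≤ 1 := by
  induction g generalizing a la with
  | zero => exact le_rfl
  | succ g ih =>
    rw [chainMass]
    refine (lintegral_mono (g := fun _ => 1) fun y => ih _ _).trans ?_
    rw [lintegral_one, Measure.restrict_apply_univ]
    exact prob_le_one

lemma chainMass_congr {γ γ' : ℕ → Measure ℝ} {τ τ' : ℕ → EReal} {lc : EReal} {g a : ℕ} {la : EReal}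
    (hγ : ∀ k, a < k → k ≤ a + g → γ k = γ' k) (hτ : ∀ k, a < k → k ≤ a + g → τ k = τ' k) :
    chainMass γ τ lc g a la = chainMass γ' τ' lc g a la := by
  induction g generalizing a la with
  | zero => rfl
  | succ g ih =>
    simp only [chainMass]
    rw [hγ (a + 1) (by omega) (by omega), hτ (a + 1) (by omega) (by omega)]
    congr 1
    ext y
    exact ih (fun k h1 h2 => hγ k (by omega) (by omega)) (fun k h1 h2 => hτ k (by omega) (by omega))

lemma measurableSet_cap (u v w : EReal) :
    MeasurableSet {y : ℝ | u ≤ y ∧ (y : EReal) ≤ v ∧ (y : EReal) ≤ w} :=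
  (measurableSet_le measurable_const measurable_coe_real_ereal).inter
    ((measurableSet_le measurable_coe_real_ereal measurable_const).inter
      (measurableSet_le measurable_coe_real_ereal measurable_const))

/-- Integrating out the term of index `b = a + h + 1` last. -/
lemma chainMass_split (γ : ℕ → Measure ℝ) [∀ k, IsProbabilityMeasure (γ k)] (lc t : EReal)
    (h g a : ℕ) (la : EReal) :
    chainMass γ (fun k => if k = a + h + 1 then t else ⊤) lc (h + 1 + g) a la
      = ∫⁻ x in {x : ℝ | lc ≤ x ∧ (x : EReal) ≤ la ∧ (x : EReal) ≤ t},
        chainMass γ (fun _ => ⊤) x h a la * chainMass γ (fun _ => ⊤) lc g (a + h + 1) x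
          ∂(γ (a + h + 1)) := by
  induction h generalizing a la with
  | zero =>
    rw [show 0 + 1 + g = g + 1 by omega, chainMass]
    simp only [add_zero, if_true]
    refine lintegral_congr fun y => ?_
    rw [chainMass, one_mul]
    exact chainMass_congr (fun _ _ _ => rfl) fun k h1 h2 => by rw [if_neg (by omega)]
  | succ h ih =>
    rw [show h + 1 + 1 + g = (h + 1 + g) + 1 by omega, chainMass]
    have e1 : a + (h + 1) + 1 = (a + 1) + h + 1 := by omega
    rw [e1]
    simp only [ih (a + 1), show ¬ (a + 1 = a + 1 + h + 1) by omega, if_false, le_top, and_true]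
    have m1 : ∀ u v : EReal, MeasurableSet {y : ℝ | u ≤ y ∧ (y : EReal) ≤ v} := fun u v => by
      simpa using measurableSet_cap u v ⊤
    -- Prepares the exchange of the first term `y` and the term `x` of index `b`. Both sides encode
    -- `lc ≤ x ≤ y ≤ la` and `x ≤ t`; the extra constraints `lc ≤ y` and `x ≤ la` follow by
    -- transitivity.
    have lhs : ∀ y : ℝ, ∀ x : ℝ, ({y : ℝ | lc ≤ y ∧ (y : EReal) ≤ la}.indicator (1 : ℝ → ℝ≥0∞) y) *
        ({x : ℝ | lc ≤ x ∧ (x : EReal) ≤ y ∧ (x : EReal) ≤ t}.indicator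
          (fun x : ℝ => chainMass γ (fun _ => ⊤) x h (a + 1) y *
            chainMass γ (fun _ => ⊤) lc g (a + 1 + h + 1) x) x)
        = ({x : ℝ | lc ≤ x ∧ (x : EReal) ≤ la ∧ (x : EReal) ≤ t}.indicator
          (1 : ℝ → ℝ≥0∞) x) *
        ({y : ℝ | x ≤ y ∧ (y : EReal) ≤ la}.indicator
          (fun y : ℝ => chainMass γ (fun _ => ⊤) x h (a + 1) y *
            chainMass γ (fun _ => ⊤) lc g (a + 1 + h + 1) x) y) := by
      intro y x
      by_cases h1 : lc ≤ x <;> by_cases h2 : x ≤ y <;> by_cases h3 : (x : EReal) ≤ t <;>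
        by_cases h4 : (y : EReal) ≤ la <;> simp [Set.indicator, h1, h2, h3, h4]
      · have h5 : lc ≤ y := h1.trans (EReal.coe_le_coe_iff.2 h2)
        have h6 : (x : EReal) ≤ la := (EReal.coe_le_coe_iff.2 h2).trans h4
        simp [h5, h6]
    have mm : ∀ k j : ℕ, Measurable fun z : ℝ × ℝ => chainMass γ (fun _ => ⊤) z.1 k j z.2 :=
      fun k j => (measurable_chainMass γ (fun _ => ⊤) k j).comp
        (measurable_fst.coe_real_ereal.prodMk measurable_snd.coe_real_ereal)
    have mm2 : ∀ k j, Measurable fun x : ℝ => chainMass γ (fun _ => ⊤) lc k j x := fun k j =>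
      (measurable_chainMass γ (fun _ => ⊤) k j).comp
        (measurable_const.prodMk measurable_coe_real_ereal)
    rw [← lintegral_indicator (m1 lc la), ← lintegral_indicator (measurableSet_cap lc la t)]
    have step1 : ∀ y : ℝ, {y : ℝ | lc ≤ y ∧ (y : EReal) ≤ la}.indicator (fun y : ℝ =>
        ∫⁻ x in {x : ℝ | lc ≤ x ∧ (x : EReal) ≤ y ∧ (x : EReal) ≤ t},
          chainMass γ (fun _ => ⊤) x h (a + 1) y *
            chainMass γ (fun _ => ⊤) lc g (a + 1 + h + 1) x ∂(γ (a + 1 + h + 1))) y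
        = ∫⁻ x : ℝ, ({y : ℝ | lc ≤ y ∧ (y : EReal) ≤ la}.indicator (1 : ℝ → ℝ≥0∞) y) *
        ({x : ℝ | lc ≤ x ∧ (x : EReal) ≤ y ∧ (x : EReal) ≤ t}.indicator
          (fun x : ℝ => chainMass γ (fun _ => ⊤) x h (a + 1) y *
            chainMass γ (fun _ => ⊤) lc g (a + 1 + h + 1) x) x) ∂(γ (a + 1 + h + 1)) := by
      intro y
      have mfun : Measurable fun x : ℝ => chainMass γ (fun _ => ⊤) x h (a + 1) y *
            chainMass γ (fun _ => ⊤) lc g (a + 1 + h + 1) x :=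
        ((mm h (a + 1)).comp (measurable_id.prodMk measurable_const)).mul (mm2 _ _)
      rw [lintegral_const_mul _ (mfun.indicator (measurableSet_cap lc y t)),
        lintegral_indicator (measurableSet_cap lc y t)]
      by_cases hy : y ∈ {y : ℝ | lc ≤ y ∧ (y : EReal) ≤ la}
      · rw [Set.indicator_of_mem hy, Set.indicator_of_mem hy, Pi.one_apply, one_mul]
      · rw [Set.indicator_of_notMem hy, Set.indicator_of_notMem hy, zero_mul]
    simp_rw [step1, lhs]
    rw [lintegral_lintegral_swap]
    · refine lintegral_congr fun x => ?_
      have m2 : MeasurableSet {y : ℝ | x ≤ y ∧ (y : EReal) ≤ la} := by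
        simpa using m1 x la
      have mx : Measurable fun y : ℝ => chainMass γ (fun _ => ⊤) x h (a + 1) y :=
        (mm h (a + 1)).comp (measurable_const.prodMk measurable_id)
      rw [lintegral_const_mul _ ((mx.mul_const _).indicator m2), lintegral_indicator m2]
      by_cases hx : x ∈ {x : ℝ | lc ≤ x ∧ (x : EReal) ≤ la ∧ (x : EReal) ≤ t}
      · rw [Set.indicator_of_mem hx, Set.indicator_of_mem hx, Pi.one_apply, one_mul,
          lintegral_mul_const _ mx]
        congr 1
        simp [chainMass]
      · rw [Set.indicator_of_notMem hx, Set.indicator_of_notMem hx, zero_mul]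
    · refine Measurable.aemeasurable ?_
      refine Measurable.mul ?_ ?_
      · exact (measurable_one.indicator (measurableSet_cap lc la t)).comp measurable_snd
      · have : (fun z : ℝ × ℝ => {y : ℝ | z.2 ≤ y ∧ (y : EReal) ≤ la}.indicator
            (fun y : ℝ => chainMass γ (fun _ => ⊤) z.2 h (a + 1) y *
              chainMass γ (fun _ => ⊤) lc g (a + 1 + h + 1) z.2) z.1)
            = {z : ℝ × ℝ | z.2 ≤ z.1 ∧ (z.1 : EReal) ≤ la}.indicator
              (fun z => chainMass γ (fun _ => ⊤) z.2 h (a + 1) z.1 *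
              chainMass γ (fun _ => ⊤) lc g (a + 1 + h + 1) z.2) := by
          ext z; rfl
        rw [this]
        refine Measurable.indicator ?_ ?_
        · exact ((mm _ _).comp measurable_swap).mul ((mm2 _ _).comp measurable_snd)
        · exact (measurableSet_le measurable_snd measurable_fst).inter
            (measurableSet_le measurable_fst.coe_real_ereal measurable_const)

/-! ### The iterated integrals as masses of decreasing sequences -/

/-- The centered Gaussian law with standard deviation `σ ρ_k`. -/
def knotLaw (σ : ℝ) (ρ : ℕ → ℝ) (k : ℕ) : Measure ℝ :=
  gaussianReal 0 ((σ * ρ k) ^ 2).toNNReal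

instance (σ : ℝ) (ρ : ℕ → ℝ) (k : ℕ) : IsProbabilityMeasure (knotLaw σ ρ k) := by
  unfold knotLaw; infer_instance

lemma toNNReal_sq_ne_zero {s : ℝ} (hs : s ≠ 0) : (s ^ 2).toNNReal ≠ 0 := by
  simpa using hs

lemma nullSingletonClass_knotLaw {σ : ℝ} {ρ : ℕ → ℝ} {k : ℕ} (h : σ * ρ k ≠ 0) :
    NullSingletonClass (knotLaw σ ρ k) :=
  nullSingletonClass_gaussianReal (toNNReal_sq_ne_zero h)

lemma isOpenPosMeasure_knotLaw {σ : ℝ} {ρ : ℕ → ℝ} {k : ℕ} (h : σ * ρ k ≠ 0) :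
    (knotLaw σ ρ k).IsOpenPosMeasure :=
  (gaussianReal_absolutelyContinuous' 0 (toNNReal_sq_ne_zero h)).isOpenPosMeasure

lemma PhiK_eq_ecdf (σ : ℝ) (ρ : ℕ → ℝ) (k : ℕ) : PhiK σ ρ k = ecdf (knotLaw σ ρ k) := rfl

/-- `Φ_k` is strictly increasing on the whole extended line, so the set in the definition of the
inverse is the half-line from `x`. Taking `x = ⊤` covers the convention `λ₀ = ∞`, `F₀ = 1`. -/
lemma PhiKInv_PhiK {σ : ℝ} {ρ : ℕ → ℝ} {k : ℕ} (h : σ * ρ k ≠ 0) (x : EReal) :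
    PhiKInv σ ρ k (PhiK σ ρ k x) = x := by
  have := isOpenPosMeasure_knotLaw h
  rw [PhiKInv, PhiK_eq_ecdf]
  simp_rw [(ecdf_strictMono (knotLaw σ ρ k)).le_iff_le]
  exact csInf_Ici

lemma calP_PhiK {σ : ℝ} {ρ : ℕ → ℝ} {i j : ℕ} (h : σ * ρ j ≠ 0) (x : EReal) :
    calP σ ρ i j (PhiK σ ρ j x) = PhiK σ ρ i x := by
  rw [calP, PhiKInv_PhiK h]

/-- With `f_k = Φ_k(x_k)`, every bound `P_{k,j}(f_j)` becomes `Φ_k(x_j)`, and Lebesgue measure in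
`f_k` becomes the law of the `k`-th knot in `x_k`. Each layer of the iterated integral is then one
layer of `chainMass`. -/
lemma iterI_PhiK {σ : ℝ} {ρ : ℕ → ℝ} {b g a : ℕ} (hb : σ * ρ b ≠ 0)
    (h : ∀ k, a ≤ k → k ≤ a + g → σ * ρ k ≠ 0) {x la : EReal} (hx : x ≤ la) :
    iterI σ ρ b (PhiK σ ρ b x) g a (PhiK σ ρ a la)
      = (chainMass (knotLaw σ ρ) (fun _ => ⊤) x g a la).toReal := by
  induction g generalizing a la with
  | zero => simp [iterI, chainMass]
  | succ g ih =>
    have h1 := h (a + 1) (by omega) (by omega)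
    have := nullSingletonClass_knotLaw h1
    have := isOpenPosMeasure_knotLaw h1
    rw [iterI, calP_PhiK hb, calP_PhiK (h a le_rfl (by omega)), PhiK_eq_ecdf σ ρ (a + 1),
      intervalIntegral_ecdf (knotLaw σ ρ (a + 1)) hx _
        (fun y => chainMass (knotLaw σ ρ) (fun _ => ⊤) x g (a + 1) y)
        ((measurable_chainMass _ _ _ _).comp (measurable_const.prodMk measurable_coe_real_ereal))
        (fun _ => chainMass_le_one _ _ _ _ _ _)
        (fun y hy _ => ih (fun k h2 h3 => h k (by omega) (by omega)) hy.le), chainMass]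
    simp

/-- `F_{abc}` is the mass of the sequences which decrease from `la` to `lc` and whose `b`-th term
is at most `t`. -/
lemma Fabc_eq_chainMass {σ : ℝ} {ρ : ℕ → ℝ} {a b c : ℕ} (hab : a < b) (hbc : b < c)
    (h : ∀ k, a ≤ k → k ≤ c → σ * ρ k ≠ 0) {la lc t : EReal} (hlt : lc ≤ t) (hta : t ≤ la) :
    Fabc σ ρ a b c la lc t
      = (chainMass (knotLaw σ ρ) (fun k => if k = b then t else ⊤) lc (c - 1 - a) a la).toReal := by
  obtain ⟨h', rfl⟩ : ∃ h', b = a + h' + 1 := ⟨b - a - 1, by omega⟩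
  obtain ⟨g, rfl⟩ : ∃ g, c = a + h' + 1 + g + 1 := ⟨c - (a + h' + 1) - 1, by omega⟩
  have hb := h (a + h' + 1) (by omega) (by omega)
  have := nullSingletonClass_knotLaw hb
  have := isOpenPosMeasure_knotLaw hb
  -- The sequence has `c - 1 - a` free terms. Those above index `b` give one factor of the integrand
  -- and those below give the other; `chainMass_split` reassembles them.
  rw [Fabc, if_pos ⟨hlt, hta⟩, show a + h' + 1 + g + 1 - 1 - a = h' + 1 + g by omega,
    chainMass_split, PhiK_eq_ecdf σ ρ (a + h' + 1),
    intervalIntegral_ecdf (knotLaw σ ρ (a + h' + 1)) hlt _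
        (fun x => chainMass (knotLaw σ ρ) (fun _ => ⊤) x h' a la *
          chainMass (knotLaw σ ρ) (fun _ => ⊤) lc g (a + h' + 1) x)]
  · congr 2
    congr 1
    ext x
    exact ⟨fun ⟨h1, h2⟩ => ⟨h1, h2.trans hta, h2⟩, fun ⟨h1, _, h2⟩ => ⟨h1, h2⟩⟩
  · exact ((measurable_chainMass _ _ _ _).comp
      (measurable_coe_real_ereal.prodMk measurable_const)).mul ((measurable_chainMass _ _ _ _).comp
      (measurable_const.prodMk measurable_coe_real_ereal))
  · exact fun x => mul_le_one' (chainMass_le_one _ _ _ _ _ _) (chainMass_le_one _ _ _ _ _ _)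
  · intro x hx hxt
    rw [calI, calI, show a + h' + 1 - a - 1 = h' by omega,
      show a + h' + 1 + g + 1 - (a + h' + 1) - 1 = g by omega, ← PhiK_eq_ecdf,
      iterI_PhiK hb (fun k h1 h2 => h k (by omega) (by omega)) (hxt.trans hta),
      iterI_PhiK (h _ (by omega) (by omega)) (fun k h1 h2 => h k (by omega) (by omega)) hx.le,
      ENNReal.toReal_mul]

lemma Fabc_eq_zero {σ : ℝ} {ρ : ℕ → ℝ} {a b c : ℕ} {la lc t : EReal} (h : ¬ (lc ≤ t ∧ t ≤ la)) :
    Fabc σ ρ a b c la lc t = 0 := if_neg h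

/-! ### Decreasing sequences as sets of a product space -/

/-- The sequences `v a, …, v (a + g - 1)` decreasing from `la` to `lc`, the term of index `k` being
capped at `τ (k + 1)`. -/
def chainSet (τ : ℕ → EReal) (lc : EReal) : (g a : ℕ) → EReal → Set (Fin g → ℝ)
  | 0, _, _ => Set.univ
  | g + 1, a, la => {v | lc ≤ v 0 ∧ (v 0 : EReal) ≤ la ∧ (v 0 : EReal) ≤ τ (a + 1) ∧
      Fin.tail v ∈ chainSet τ lc g (a + 1) (v 0)}

lemma chainSet_subset_top (τ : ℕ → EReal) (lc : EReal) (g a : ℕ) (la : EReal) :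
    chainSet τ lc g a la ⊆ chainSet (fun _ => ⊤) lc g a la := by
  induction g generalizing a la with
  | zero => exact le_rfl
  | succ g ih => exact fun v hv => ⟨hv.1, hv.2.1, le_top, ih _ _ hv.2.2.2⟩

lemma measurableSet_chainSet_prod (τ : ℕ → EReal) (g a : ℕ) :
    MeasurableSet {z : (EReal × EReal) × (Fin g → ℝ) | z.2 ∈ chainSet τ z.1.1 g a z.1.2} := by
  induction g generalizing a with
  | zero => simp [chainSet]
  | succ g ih =>
    have h0 : Measurable fun z : (EReal × EReal) × (Fin (g + 1) → ℝ) => (z.2 0 : EReal) :=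
      ((measurable_pi_apply 0).comp measurable_snd).coe_real_ereal
    have ht : Measurable fun z : (EReal × EReal) × (Fin (g + 1) → ℝ) => (Fin.tail z.2) :=
      measurable_pi_lambda _ fun k => (measurable_pi_apply _).comp measurable_snd
    exact (measurableSet_le measurable_fst.fst h0).inter
      ((measurableSet_le h0 measurable_fst.snd).inter ((measurableSet_le h0 measurable_const).inter
        ((ih (a + 1)).preimage ((measurable_fst.fst.prodMk h0).prodMk ht))))

lemma measurableSet_chainSet (τ : ℕ → EReal) (lc : EReal) (g a : ℕ) (la : EReal) :
    MeasurableSet (chainSet τ lc g a la) :=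
  (measurableSet_chainSet_prod τ g a).preimage (measurable_prodMk_left (x := (lc, la)))

/-- Split off the first coordinate and apply Fubini: the section at `y` is the chain set that starts
from `y`, or is empty if `y` violates its own constraints. -/
lemma pi_chainSet (γ : ℕ → Measure ℝ) [∀ k, IsProbabilityMeasure (γ k)] (τ : ℕ → EReal)
    (lc : EReal) (g a : ℕ) (la : EReal) :
    Measure.pi (fun k : Fin g => γ (a + 1 + k)) (chainSet τ lc g a la)
      = chainMass γ τ lc g a la := by
  induction g generalizing a la with
  | zero => simp [chainSet, chainMass]
  | succ g ih =>
    have mp := (measurePreserving_piFinSuccAbove (fun k : Fin (g + 1) => γ (a + 1 + k)) 0).symm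
    rw [← mp.measure_preimage (measurableSet_chainSet _ _ _ _ _).nullMeasurableSet,
      Measure.prod_apply ((measurableSet_chainSet _ _ _ _ _).preimage mp.measurable), chainMass,
      ← lintegral_indicator (measurableSet_cap _ _ _)]
    refine lintegral_congr fun y => ?_
    have e : (fun j : Fin g => γ (a + 1 + ((0 : Fin (g + 1)).succAbove j : Fin (g + 1))))
        = fun k : Fin g => γ (a + 1 + 1 + k) := by
      ext1 j
      congr 1
      simp
      omega
    by_cases hy : y ∈ {y : ℝ | lc ≤ y ∧ (y : EReal) ≤ la ∧ (y : EReal) ≤ τ (a + 1)}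
    · rw [Set.indicator_of_mem hy, ← ih (a + 1) y, e]
      congr 1
      ext v
      obtain ⟨h1, h2, h3⟩ := hy
      simp [chainSet, MeasurableEquiv.piFinSuccAbove, Fin.insertNthEquiv, h1, h2, h3]
    · rw [Set.indicator_of_notMem hy, e]
      refine (congrArg _ (Set.eq_empty_of_forall_notMem fun v hv => hy ?_)).trans measure_empty
      simp [chainSet, MeasurableEquiv.piFinSuccAbove, Fin.insertNthEquiv] at hv
      exact ⟨hv.1, hv.2.1, hv.2.2.1⟩

/-- A finite real sequence lies in the chain set iff the sequence completed by the end points is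
non-increasing and the caps hold. -/
lemma mem_chainSet_iff {τ : ℕ → EReal} {g a : ℕ} {κ : ℕ → EReal} {v : Fin g → ℝ} (hg : 1 ≤ g)
    (hv : ∀ k : Fin g, κ (a + 1 + k) = v k) :
    v ∈ chainSet τ (κ (a + g + 1)) g a (κ a) ↔
      (∀ k, a ≤ k → k ≤ a + g → κ (k + 1) ≤ κ k) ∧ ∀ k : Fin g, (v k : EReal) ≤ τ (a + 1 + k) := by
  induction g generalizing a with
  -- The case without a free term is excluded because the chain set is then everything and does not
  -- compare the two end points.
  | zero => omega
  | succ g ih =>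
    have h0 : κ (a + 1) = v 0 := by simpa using hv 0
    have htail : ∀ k : Fin g, κ (a + 1 + 1 + k) = (Fin.tail v k : ℝ) := fun k => by
      rw [Fin.tail, ← hv k.succ]
      congr 1
      simp
      omega
    rcases Nat.eq_zero_or_pos g with rfl | hg'
    · simp only [chainSet, Set.mem_ofPred_eq, Set.mem_univ, and_true, ← h0]
      constructor
      · rintro ⟨h1, h2, h3⟩
        refine ⟨fun k hk hk' => ?_, fun k => ?_⟩
        · obtain rfl | rfl : k = a ∨ k = a + 1 := by omega
          · exact h2
          · exact h1
        · obtain rfl : k = 0 := Fin.fin_one_eq_zero k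
          rw [← h0]; simpa using h3
      · rintro ⟨h1, h2⟩
        have := h2 0
        rw [← h0] at this
        exact ⟨h1 (a + 1) (by omega) (by omega), h1 a (by omega) (by omega), by simpa using this⟩
    · have key := ih (a := a + 1) hg' htail
      rw [show a + (g + 1) + 1 = a + 1 + g + 1 by omega]
      simp only [chainSet, Set.mem_ofPred_eq, ← h0, key, Fin.forall_fin_succ (n := g), Fin.val_zero,
        add_zero]
      constructor
      · rintro ⟨h1, h2, h3, h4, h5⟩
        refine ⟨fun k hk hk' => ?_, h3, fun k => ?_⟩
        · rcases hk.eq_or_lt with rfl | hk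
          · exact h2
          · exact h4 k (by omega) (by omega)
        · have := h5 k
          rw [Fin.val_succ, show a + 1 + (k + 1) = a + 1 + 1 + k by omega]
          exact this
      · rintro ⟨h1, h2, h3⟩
        -- The chain set bounds the first term directly by the lower end point, a condition that
        -- follows by transitivity along the sequence.
        have hanti : ∀ j, a + 1 + j ≤ a + 1 + g + 1 → κ (a + 1 + j) ≤ κ (a + 1) := by
          intro j
          induction j with
          | zero => intro; exact le_rfl
          | succ j ihj => intro hj; exact (h1 (a + 1 + j) (by omega) (by omega)).trans (ihj (by omega))
        refine ⟨hanti (g + 1) (by omega), h1 a (by omega) (by omega), h2,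
          fun k hk hk' => h1 k (by omega) (by omega), fun k => ?_⟩
        have := h3 k
        rw [Fin.val_succ, show a + 1 + (k + 1) = a + 1 + 1 + k by omega] at this
        exact this

/-! ### Conditioning on an independent variable -/

/-- If the variable `v`, of law `π`, is independent of `w`, then the conditional probability of
`S'` given `w` and the event `S ⊇ S'` is the ratio of the masses of the sections. -/
lemma setLIntegral_section_ratio {α β : Type*} [MeasurableSpace α] [MeasurableSpace β]
    (m : Measure α) [IsFiniteMeasure m] (π : Measure β) [IsProbabilityMeasure π] {S S' : Set (α × β)}
    (hS : MeasurableSet S) (hS' : MeasurableSet S') (hSS : S' ⊆ S) {B : Set α}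
    (hB : MeasurableSet B) {f : α → ℝ≥0∞} (hfm : Measurable f)
    (hf : ∀ w ∈ B, f w = π (Prod.mk w ⁻¹' S') / π (Prod.mk w ⁻¹' S)) :
    ∫⁻ z in S ∩ Prod.fst ⁻¹' B, f z.1 ∂(m.prod π) = m.prod π (S' ∩ Prod.fst ⁻¹' B) := by
  have hSB := hS.inter (measurable_fst hB : MeasurableSet (Prod.fst ⁻¹' B : Set (α × β)))
  have hSB' := hS'.inter (measurable_fst hB : MeasurableSet (Prod.fst ⁻¹' B : Set (α × β)))
  have hfm' : Measurable fun z : α × β => f z.1 := hfm.comp measurable_fst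
  rw [← lintegral_indicator hSB, lintegral_prod _ (hfm'.indicator hSB).aemeasurable,
    Measure.prod_apply hSB']
  refine lintegral_congr fun w => ?_
  by_cases hw : w ∈ B
  · have h1 : Prod.mk w ⁻¹' (S' ∩ Prod.fst ⁻¹' B) = Prod.mk w ⁻¹' S' := by
      ext v; simp [hw]
    have h2 : (fun v => (S ∩ Prod.fst ⁻¹' B).indicator (fun z : α × β => f z.1) (w, v))
        = (Prod.mk w ⁻¹' S).indicator fun _ => f w := by
      ext v
      by_cases hv : (w, v) ∈ S <;> simp [Set.indicator, hv, hw]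
    have h3 : π (Prod.mk w ⁻¹' S') ≤ π (Prod.mk w ⁻¹' S) := measure_mono fun v hv => hSS hv
    rw [h1, h2, lintegral_indicator_const (measurable_prodMk_left hS), hf w hw]
    -- On a null section of `S` the section of `S'` is null as well, so both sides vanish whatever
    -- the quotient is.
    rcases eq_or_ne (π (Prod.mk w ⁻¹' S)) 0 with h0 | h0
    · rw [h0, mul_zero, eq_comm]; exact le_antisymm (h0 ▸ h3) bot_le
    · exact ENNReal.div_mul_cancel h0 (measure_ne_top _ _)
  · have h1 : Prod.mk w ⁻¹' (S' ∩ Prod.fst ⁻¹' B) = ∅ := by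
      ext v; simp [hw]
    have h2 : (fun v => (S ∩ Prod.fst ⁻¹' B).indicator (fun z : α × β => f z.1) (w, v)) = 0 := by
      ext v; simp [hw]
    rw [h1, h2, measure_empty]; exact lintegral_zero

/-- Almost every point of `S` lies in a section of positive mass. -/
lemma measure_section_null {α β : Type*} [MeasurableSpace α] [MeasurableSpace β]
    (m : Measure α) [IsFiniteMeasure m] (π : Measure β) [IsProbabilityMeasure π] {S : Set (α × β)}
    (hS : MeasurableSet S) : m.prod π (S ∩ {z | π (Prod.mk z.1 ⁻¹' S) = 0}) = 0 := by
  have h0 : MeasurableSet {z : α × β | π (Prod.mk z.1 ⁻¹' S) = 0} :=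
    ((measurable_measure_prodMk_left hS).comp measurable_fst) (measurableSet_singleton 0)
  rw [Measure.prod_apply (hS.inter h0)]
  refine (lintegral_congr fun w => ?_).trans lintegral_zero
  by_cases hw : π (Prod.mk w ⁻¹' S) = 0
  · exact le_antisymm ((measure_mono fun v hv => hv.1).trans hw.le) bot_le
  · have : Prod.mk w ⁻¹' (S ∩ {z | π (Prod.mk z.1 ⁻¹' S) = 0}) = ∅ := by
      ext v; simp [hw]
    rw [this, measure_empty]

/-! ### Regression on signed columns in Euclidean terms -/

section Geometry

variable {n p : ℕ} (X : Matrix (Fin n) (Fin p) ℝ)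

/-- The column of the design attached to a signed variable, with its sign. -/
def signedColumn (j : Fin (p + p)) : EuclideanSpace ℝ (Fin n) :=
  Fin.addCases (column X) (fun j => -column X j) j

lemma signedColumn_castAdd (j : Fin p) : signedColumn X (Fin.castAdd p j) = column X j := by
  simp [signedColumn]

lemma signedColumn_natAdd (j : Fin p) : signedColumn X (Fin.natAdd p j) = -column X j := by
  simp [signedColumn, -Fin.natAdd_eq_addNat]

lemma inner_column (j : Fin p) (y : EuclideanSpace ℝ (Fin n)) :
    ⟪column X j, y⟫ = (Xᵀ *ᵥ y.ofLp) j := by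
  simp [column, PiLp.inner_apply, Matrix.mulVec, dotProduct, mul_comm]

lemma corr_eq_inner (y : EuclideanSpace ℝ (Fin n)) (j : Fin (p + p)) :
    corr X y j = ⟪signedColumn X j, y⟫ := by
  refine Fin.addCases (fun j => ?_) (fun j => ?_) j
  · simp [corr, signedColumn_castAdd, inner_column]
  · simp [corr, signedColumn_natAdd, inner_column, inner_neg_left, -Fin.natAdd_eq_addNat]

lemma inner_column_column (i j : Fin p) : ⟪column X i, column X j⟫ = (Xᵀ * X) i j := by
  rw [inner_column]; rfl

/-- Together with `corr_eq_inner`, this expresses `R` and `Z` through signed columns, so that the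
sign blocks no longer have to be treated separately. -/
lemma gram_eq_inner (i j : Fin (p + p)) : gram X i j = ⟪signedColumn X i, signedColumn X j⟫ := by
  refine Fin.addCases (fun i => ?_) (fun i => ?_) i <;>
    refine Fin.addCases (fun j => ?_) (fun j => ?_) j <;>
    simp [gram, signedColumn_castAdd, signedColumn_natAdd, inner_column_column, inner_neg_left,
      inner_neg_right, -Fin.natAdd_eq_addNat]

lemma signedColumn_eq_or (j : Fin (p + p)) :
    signedColumn X j = column X (unsigned j) ∨ signedColumn X j = -column X (unsigned j) := by
  refine Fin.addCases (fun j => ?_) (fun j => ?_) j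
  · left; simp [signedColumn_castAdd, unsigned]
  · right; simp [signedColumn_natAdd, unsigned, -Fin.natAdd_eq_addNat]

variable {k : ℕ} (i : Fin k → Fin (p + p)) (j : Fin (p + p))

lemma selectedSpan_eq_span_signedColumn :
    selectedSpan X i = Submodule.span ℝ (Set.range fun l => signedColumn X (i l)) := by
  apply le_antisymm <;> refine Submodule.span_le.2 ?_ <;> rintro _ ⟨l, rfl⟩ <;>
    rcases signedColumn_eq_or X (i l) with h | h
  · show column X (unsigned (i l)) ∈ _
    rw [← h]; exact Submodule.subset_span ⟨l, rfl⟩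
  · have : signedColumn X (i l) ∈ Submodule.span ℝ (Set.range fun l => signedColumn X (i l)) :=
      Submodule.subset_span ⟨l, rfl⟩
    rw [h] at this
    simpa using this
  · show signedColumn X (i l) ∈ selectedSpan X i
    rw [h]; exact Submodule.subset_span ⟨l, rfl⟩
  · show signedColumn X (i l) ∈ selectedSpan X i
    rw [h]; exact Submodule.neg_mem _ (Submodule.subset_span ⟨l, rfl⟩)

/-- The coefficients of the regression of the variable `j` on the variables `i`. -/
def regressCoef : Fin k → ℝ := (fun l => gram X j (i l)) ᵥ* ((gram X).submatrix i i)⁻¹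

/-- The residual of the regression of the signed column `j` on the signed columns `i`. -/
def residual : EuclideanSpace ℝ (Fin n) :=
  signedColumn X j - ∑ l, regressCoef X i j l • signedColumn X (i l)

/-- The vector representing the linear form `y ↦ Z_j^{(i)}`. -/
def frozenVec : EuclideanSpace ℝ (Fin n) := (1 - theta X i j)⁻¹ • residual X i j

lemma regress_eq_sum (v : Fin k → ℝ) : regress X i j v = ∑ l, regressCoef X i j l * v l := by
  rw [regress, Matrix.dotProduct_mulVec]; rfl

/-- The frozen correlation is linear in `y`; all later arguments on independence and ties work with
the representing vector. -/
lemma frozenZ_eq_inner (y : EuclideanSpace ℝ (Fin n)) :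
    frozenZ X y i j = ⟪frozenVec X i j, y⟫ := by
  rw [frozenZ, frozenVec, real_inner_smul_left, residual, inner_sub_left, sum_inner,
    regress_eq_sum, corr_eq_inner, div_eq_inv_mul]
  simp [corr_eq_inner, real_inner_smul_left]

/-- Linear independence of the columns of a list of signed variables. -/
abbrev Independent : Prop := LinearIndependent ℝ fun l => signedColumn X (i l)

variable {X i}

lemma submatrix_gram_eq : (gram X).submatrix i i = Matrix.gram ℝ fun l => signedColumn X (i l) := by
  ext l m; simp [gram_eq_inner, Matrix.gram]

lemma Independent.isUnit_det (h : Independent X i) : IsUnit ((gram X).submatrix i i).det := by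
  rw [submatrix_gram_eq]
  exact ((Matrix.posDef_gram_of_linearIndependent h).det_pos).ne'.isUnit

/-- These are the normal equations; independence of the columns makes the Gram matrix invertible. -/
lemma Independent.inner_residual (h : Independent X i) (m : Fin k) :
    ⟪residual X i j, signedColumn X (i m)⟫ = 0 := by
  have h1 : (regressCoef X i j ᵥ* (gram X).submatrix i i) m = gram X j (i m) := by
    rw [regressCoef, Matrix.vecMul_vecMul, Matrix.nonsing_inv_mul _ h.isUnit_det,
      Matrix.vecMul_one]
  rw [residual, inner_sub_left, sum_inner, ← gram_eq_inner, ← h1, sub_eq_zero]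
  simp [Matrix.vecMul, dotProduct, real_inner_smul_left, gram_eq_inner]

lemma Independent.residual_mem_orthogonal (h : Independent X i) :
    residual X i j ∈ (selectedSpan X i)ᗮ := by
  rw [selectedSpan_eq_span_signedColumn, Submodule.mem_orthogonal']
  intro u hu
  induction hu using Submodule.span_induction with
  | mem x hx => obtain ⟨m, rfl⟩ := hx; exact h.inner_residual j m
  | zero => simp
  | add x y _ _ hx hy => rw [inner_add_right, hx, hy, add_zero]
  | smul c x _ hx => rw [inner_smul_right, hx, mul_zero]

variable (X i) in
lemma sub_residual_mem : signedColumn X j - residual X i j ∈ selectedSpan X i := by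
  rw [residual, sub_sub_cancel, selectedSpan_eq_span_signedColumn]
  exact Submodule.sum_mem _ fun l _ => Submodule.smul_mem _ _ (Submodule.subset_span ⟨l, rfl⟩)

/-- Uniqueness of the orthogonal decomposition. It computes residuals after a change of the list
without inverting a matrix again. -/
lemma Independent.residual_eq (h : Independent X i) {r : EuclideanSpace ℝ (Fin n)}
    (hr : signedColumn X j - r ∈ selectedSpan X i) (hr' : r ∈ (selectedSpan X i)ᗮ) :
    residual X i j = r := by
  have h1 : residual X i j - r ∈ selectedSpan X i := by
    have := Submodule.sub_mem _ hr (sub_residual_mem X i j)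
    rwa [sub_sub_sub_cancel_left] at this
  have h2 : residual X i j - r ∈ (selectedSpan X i)ᗮ :=
    Submodule.sub_mem _ (h.residual_mem_orthogonal j) hr'
  exact sub_eq_zero.1 (inner_self_eq_zero.1 ((Submodule.mem_orthogonal _ _).1 h2 _ h1))

lemma Independent.residual_eq_zero_iff (h : Independent X i) :
    residual X i j = 0 ↔ signedColumn X j ∈ selectedSpan X i := by
  constructor
  · intro h0
    have := sub_residual_mem X i j
    rwa [h0, sub_zero] at this
  · intro h0
    exact h.residual_eq j (by simpa using h0) (Submodule.zero_mem _)

variable (X i) in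
/-- The vector of the span of the signed columns `i` whose inner product with each is `1`. -/
def equiangular : EuclideanSpace ℝ (Fin n) :=
  ∑ l, (((gram X).submatrix i i)⁻¹ *ᵥ fun _ => 1) l • signedColumn X (i l)

variable (X i) in
lemma theta_eq_inner : theta X i j = ⟪equiangular X i, signedColumn X j⟫ := by
  rw [theta, regress, equiangular, sum_inner, dotProduct]
  refine Finset.sum_congr rfl fun l _ => ?_
  rw [real_inner_smul_left, gram_eq_inner, real_inner_comm, mul_comm]

variable (X i) in
lemma equiangular_mem : equiangular X i ∈ selectedSpan X i := by
  rw [selectedSpan_eq_span_signedColumn]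
  exact Submodule.sum_mem _ fun l _ => Submodule.smul_mem _ _ (Submodule.subset_span ⟨l, rfl⟩)

lemma Independent.theta_self (h : Independent X i) (m : Fin k) : theta X i (i m) = 1 := by
  have h1 : ((gram X).submatrix i i *ᵥ (((gram X).submatrix i i)⁻¹ *ᵥ fun _ => 1)) m = 1 := by
    rw [Matrix.mulVec_mulVec, Matrix.mul_nonsing_inv _ h.isUnit_det, Matrix.one_mulVec]
  rw [theta_eq_inner, equiangular, sum_inner]
  refine Eq.trans ?_ h1
  generalize (((gram X).submatrix i i)⁻¹ *ᵥ fun _ => (1 : ℝ)) = v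
  rw [Matrix.mulVec, dotProduct]
  refine Finset.sum_congr rfl fun l _ => ?_
  rw [real_inner_smul_left, Matrix.submatrix_apply, gram_eq_inner, real_inner_comm, mul_comm]

/-- A vector of the span is determined by its inner products with the generators. The function `θ`
can thus be read off any vector of the span whose inner products with the selected columns are all
`1`. -/
lemma Independent.theta_eq (h : Independent X i) {w : EuclideanSpace ℝ (Fin n)}
    (hw : w ∈ selectedSpan X i) (hw' : ∀ m, ⟪w, signedColumn X (i m)⟫ = 1) :
    theta X i j = ⟪w, signedColumn X j⟫ := by
  have h2 : equiangular X i - w ∈ (selectedSpan X i)ᗮ := by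
    rw [selectedSpan_eq_span_signedColumn, Submodule.mem_orthogonal']
    intro u hu
    induction hu using Submodule.span_induction with
    | mem x hx =>
      obtain ⟨m, rfl⟩ := hx
      rw [inner_sub_left, ← theta_eq_inner, h.theta_self, hw', sub_self]
    | zero => simp
    | add x y _ _ hx hy => rw [inner_add_right, hx, hy, add_zero]
    | smul c x _ hx => rw [inner_smul_right, hx, mul_zero]
  have h1 : equiangular X i - w ∈ selectedSpan X i := Submodule.sub_mem _ (equiangular_mem X i) hw
  have h3 := sub_eq_zero.1 (inner_self_eq_zero.1 ((Submodule.mem_orthogonal _ _).1 h2 _ h1))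
  rw [theta_eq_inner, h3]

/-- Appending a signed variable to a list. -/
abbrev snocVar (i : Fin k → Fin (p + p)) (m : Fin (p + p)) : Fin (k + 1) → Fin (p + p) :=
  Fin.snoc (α := fun _ => Fin (p + p)) i m

lemma Independent.snocVar (h : Independent X i) {m : Fin (p + p)} (hm : residual X i m ≠ 0) :
    Independent X (snocVar i m) := by
  have e : (fun l => signedColumn X (LAR.snocVar i m l))
      = Fin.snoc (α := fun _ => EuclideanSpace ℝ (Fin n)) (fun l => signedColumn X (i l)) (signedColumn X m) := by
    ext1 l
    refine Fin.lastCases ?_ (fun l => ?_) l <;> simp [LAR.snocVar]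
  rw [Independent, e]
  refine h.finSnoc ?_
  rw [← selectedSpan_eq_span_signedColumn]
  exact fun h' => hm ((h.residual_eq_zero_iff m).2 h')

lemma selectedSpan_snocVar (m : Fin (p + p)) :
    selectedSpan X i ≤ selectedSpan X (snocVar i m) ∧
      signedColumn X m ∈ selectedSpan X (snocVar i m) := by
  rw [selectedSpan_eq_span_signedColumn, selectedSpan_eq_span_signedColumn]
  constructor
  · refine Submodule.span_mono ?_
    rintro _ ⟨l, rfl⟩
    exact ⟨l.castSucc, by simp [snocVar]⟩
  · exact Submodule.subset_span ⟨Fin.last k, by simp [snocVar]⟩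

/-- Effect on the residuals of adding a variable to the regression. -/
lemma Independent.residual_snocVar (h : Independent X i) {m : Fin (p + p)}
    (hm : residual X i m ≠ 0) :
    residual X (LAR.snocVar i m) j = residual X i j -
      (⟪residual X i m, signedColumn X j⟫ / ‖residual X i m‖ ^ 2) • residual X i m := by
  have hr : residual X i m ∈ selectedSpan X (LAR.snocVar i m) := by
    have h1 := (selectedSpan_snocVar (X := X) (i := i) m).2
    have h2 := (selectedSpan_snocVar (X := X) (i := i) m).1 (sub_residual_mem X i m)
    simpa using Submodule.sub_mem _ h1 h2
  have hn : ‖residual X i m‖ ^ 2 ≠ 0 := by simpa using hm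
  have hself : ∀ l, ⟪residual X i m, residual X i l⟫ = ⟪residual X i m, signedColumn X l⟫ := by
    intro l
    have := (Submodule.mem_orthogonal' _ _).1 (h.residual_mem_orthogonal m) _ (sub_residual_mem X i l)
    rw [inner_sub_right, sub_eq_zero] at this
    exact this.symm
  -- A Gram–Schmidt step: subtracting the component along the residual of `m` keeps orthogonality to
  -- the old columns and gains it for `m`.
  refine (h.snocVar hm).residual_eq j ?_ ?_
  · rw [← sub_add]
    exact Submodule.add_mem _ ((selectedSpan_snocVar m).1 (sub_residual_mem X i j))
      (Submodule.smul_mem _ _ hr)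
  · rw [selectedSpan_eq_span_signedColumn, Submodule.mem_orthogonal']
    intro u hu
    induction hu using Submodule.span_induction with
    | mem x hx =>
      obtain ⟨l, rfl⟩ := hx
      refine Fin.lastCases ?_ (fun l => ?_) l
      · simp only [LAR.snocVar, Fin.snoc_last]
        rw [inner_sub_left, real_inner_smul_left, ← hself m, real_inner_self_eq_norm_sq,
          div_mul_cancel₀ _ hn]
        have := (Submodule.mem_orthogonal' _ _).1 (h.residual_mem_orthogonal j) _
          (sub_residual_mem X i m)
        rw [inner_sub_right, sub_eq_zero] at this
        rw [this, ← hself, real_inner_comm, sub_self]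
      · simp only [LAR.snocVar, Fin.snoc_castSucc]
        rw [inner_sub_left, real_inner_smul_left, h.inner_residual, h.inner_residual]; simp
    | zero => simp
    | add x y _ _ hx hy => rw [inner_add_right, hx, hy, add_zero]
    | smul c x _ hx => rw [inner_smul_right, hx, mul_zero]

/-- Effect on `θ` of adding a variable to the regression. -/
lemma Independent.theta_snocVar (h : Independent X i) {m : Fin (p + p)}
    (hm : residual X i m ≠ 0) :
    theta X (LAR.snocVar i m) j = theta X i j + (1 - theta X i m) *
      (⟪residual X i m, signedColumn X j⟫ / ‖residual X i m‖ ^ 2) := by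
  have hr : residual X i m ∈ selectedSpan X (LAR.snocVar i m) := by
    have h1 := (selectedSpan_snocVar (X := X) (i := i) m).2
    have h2 := (selectedSpan_snocVar (X := X) (i := i) m).1 (sub_residual_mem X i m)
    simpa using Submodule.sub_mem _ h1 h2
  have hn : ‖residual X i m‖ ^ 2 ≠ 0 := by simpa using hm
  have hself : ⟪residual X i m, signedColumn X m⟫ = ‖residual X i m‖ ^ 2 := by
    have := (Submodule.mem_orthogonal' _ _).1 (h.residual_mem_orthogonal m) _ (sub_residual_mem X i m)
    rw [inner_sub_right, sub_eq_zero, real_inner_self_eq_norm_sq] at this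
    exact this
  -- The correction is along the residual of `m`, so that old inner products stay equal to `1`; its
  -- coefficient is the one that makes the inner product with column `m` equal to `1`.
  rw [(h.snocVar hm).theta_eq (w := equiangular X i +
    ((1 - theta X i m) / ‖residual X i m‖ ^ 2) • residual X i m) j]
  · rw [inner_add_left, real_inner_smul_left, ← theta_eq_inner]; ring
  · exact Submodule.add_mem _ ((selectedSpan_snocVar m).1 (equiangular_mem X i))
      (Submodule.smul_mem _ _ hr)
  · intro l
    refine Fin.lastCases ?_ (fun l => ?_) l
    · simp only [LAR.snocVar, Fin.snoc_last]
      rw [inner_add_left, real_inner_smul_left, ← theta_eq_inner, hself, div_mul_cancel₀ _ hn]; ring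
    · simp only [LAR.snocVar, Fin.snoc_castSucc]
      rw [inner_add_left, real_inner_smul_left, ← theta_eq_inner, h.theta_self, h.inner_residual]
      ring

/-- Comparison of the frozen correlations before and after the variable `m` enters. -/
lemma Independent.frozenZ_snocVar_cmp (h : Independent X i) {m : Fin (p + p)}
    (hm : residual X i m ≠ 0) (hm1 : theta X i m < 1) (hj : theta X i j < 1)
    (hj' : theta X (LAR.snocVar i m) j < 1) (y : EuclideanSpace ℝ (Fin n)) :
    frozenZ X y (LAR.snocVar i m) j ≤ frozenZ X y i m ↔ frozenZ X y i j ≤ frozenZ X y i m := by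
  have e1 := h.theta_snocVar j hm
  have e2 := h.residual_snocVar j hm
  have f : ∀ {k' : ℕ} (i' : Fin k' → Fin (p + p)) (l : Fin (p + p)),
      frozenZ X y i' l = ⟪residual X i' l, y⟫ / (1 - theta X i' l) := by
    intro k' i' l
    rw [frozenZ_eq_inner, frozenVec, real_inner_smul_left, div_eq_inv_mul]
  rw [f, f, f, e2, inner_sub_left, real_inner_smul_left]
  set g := ⟪residual X i m, signedColumn X j⟫ / ‖residual X i m‖ ^ 2
  set N := ⟪residual X i j, y⟫
  set M := ⟪residual X i m, y⟫
  have p1 : 0 < 1 - theta X i j := by linarith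
  have p2 : 0 < 1 - theta X i m := by linarith
  have p3 : 0 < 1 - theta X (LAR.snocVar i m) j := by linarith
  -- The new numerator is `N - g M` and the new denominator is `(1 - θ_j) - g (1 - θ_m)`. After
  -- cross-multiplication by `1 - θ_m` and `M`, the terms in `g` cancel and both inequalities say `N
  -- (1 - θ_m) ≤ M (1 - θ_j)`.
  rw [div_le_div_iff₀ p3 p2, div_le_div_iff₀ p1 p2, e1]
  constructor <;> intro hh <;> nlinarith

end Geometry

/-! ### The path along a fixed sequence of variables -/

section Path

variable {n p : ℕ} {X : Matrix (Fin n) (Fin p) ℝ} {y : EuclideanSpace ℝ (Fin n)}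

lemma theta_zero (i : Fin 0 → Fin (p + p)) (j : Fin (p + p)) : theta X i j = 0 := by
  simp [theta, regress]

/-- Otherwise `k` vectors would span the column space, whose dimension is the rank. -/
lemma exists_column_notMem {k : ℕ} (i : Fin k → Fin (p + p)) (hk : k < X.rank) :
    ∃ j : Fin p, column X j ∉ selectedSpan X i := by
  by_contra! h
  have h1 : Submodule.span ℝ (Set.range (column X)) ≤ selectedSpan X i :=
    Submodule.span_le.2 (by rintro _ ⟨j, rfl⟩; exact h j)
  have h2 : Module.finrank ℝ (Submodule.span ℝ (Set.range (column X))) = X.rank := by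
    rw [Matrix.rank_eq_finrank_span_cols,
      ← LinearEquiv.finrank_map_eq (WithLp.linearEquiv 2 ℝ (Fin n → ℝ)) _, Submodule.map_span,
      ← Set.range_comp]
    rfl
  have h3 : Module.finrank ℝ (selectedSpan X i) ≤ k := by
    have := finrank_range_le_card (R := ℝ) (fun l => column X (unsigned (i l)))
    rwa [Fintype.card_fin] at this
  have h4 := Submodule.finrank_mono h1
  omega

variable (X y) in
/-- Observations at which no two distinct frozen linear forms agree and no nonzero one vanishes. -/
def Generic : Prop := ∀ (k : ℕ) (i : Fin k → Fin (p + p)) (l m : Fin (p + p)),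
  (frozenZ X y i l = frozenZ X y i m → frozenVec X i l = frozenVec X i m) ∧
    (frozenZ X y i l = 0 → frozenVec X i l = 0)

lemma mem_maximizers {k : ℕ} {i : Fin k → Fin (p + p)} {m : Fin (p + p)} :
    m ∈ maximizers X y i ↔
      theta X i m < 1 ∧ ∀ l, theta X i l < 1 → frozenZ X y i l ≤ frozenZ X y i m := by
  simp [maximizers]

lemma maximizers_nonempty {k : ℕ} {i : Fin k → Fin (p + p)} {m : Fin (p + p)}
    (hm : theta X i m < 1) : (maximizers X y i).Nonempty := by
  classical
  obtain ⟨l, hl, h⟩ := Finset.exists_max_image ({j | theta X i j < 1} : Finset (Fin (p + p)))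
    (frozenZ X y i) ⟨m, by simpa using hm⟩
  refine ⟨l, mem_maximizers.2 ⟨by simpa using hl, fun l' hl' => h l' (by simpa using hl')⟩⟩

lemma nextKnot_eq {k : ℕ} {i : Fin k → Fin (p + p)} {m : Fin (p + p)}
    (hm : m ∈ maximizers X y i) : nextKnot X y i = frozenZ X y i m := by
  rw [mem_maximizers] at hm
  have : Nonempty {j : Fin (p + p) // theta X i j < 1} := ⟨⟨m, hm.1⟩⟩
  exact le_antisymm (ciSup_le fun l => hm.2 l l.2)
    (le_ciSup (f := fun j : {j : Fin (p + p) // theta X i j < 1} => frozenZ X y i j)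
      (Set.finite_range _).bddAbove ⟨m, hm.1⟩)

lemma le_nextKnot {k : ℕ} {i : Fin k → Fin (p + p)} {l : Fin (p + p)}
    (hl : theta X i l < 1) : frozenZ X y i l ≤ nextKnot X y i :=
  le_ciSup (f := fun j : {j : Fin (p + p) // theta X i j < 1} => frozenZ X y i j)
      (Set.finite_range _).bddAbove ⟨l, hl⟩

lemma nextIndex_mem [NeZero p] {k : ℕ} {i : Fin k → Fin (p + p)}
    (h : (maximizers X y i).Nonempty) : nextIndex X y i ∈ maximizers X y i := by
  rw [nextIndex, dif_pos h]
  exact Finset.min'_mem _ _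

lemma frozenVec_ne_zero {k : ℕ} {i : Fin k → Fin (p + p)} {j : Fin (p + p)}
    (hr : residual X i j ≠ 0) (hθ : theta X i j < 1) : frozenVec X i j ≠ 0 :=
  smul_ne_zero (inv_ne_zero (by linarith)) hr

lemma frozenZ_mul {k : ℕ} {i : Fin k → Fin (p + p)} {j : Fin (p + p)}
    (hθ : theta X i j < 1) : frozenZ X y i j * (1 - theta X i j) = ⟪residual X i j, y⟫ := by
  rw [frozenZ_eq_inner, frozenVec, real_inner_smul_left]
  field_simp [show 1 - theta X i j ≠ 0 by linarith]

/-- A column outside the span, taken with its two signs, has opposite residuals; both signs are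
admissible, so one of the two frozen correlations is positive, genericity excluding zero. -/
lemma exists_frozenZ_pos {k : ℕ} {i : Fin k → Fin (p + p)} (hi : Independent X i)
    (hk : k < X.rank) (hθ : ∀ j, (∀ l, j ≠ i l) → theta X i j < 1) (hy : Generic X y) :
    ∃ j, theta X i j < 1 ∧ 0 < frozenZ X y i j := by
  obtain ⟨j, hj⟩ := exists_column_notMem i hk
  have hmem : ∀ l, signedColumn X (i l) ∈ selectedSpan X i := fun l => by
    rw [selectedSpan_eq_span_signedColumn]; exact Submodule.subset_span ⟨l, rfl⟩
  have c0 : signedColumn X (Fin.castAdd p j) ∉ selectedSpan X i := by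
    rwa [signedColumn_castAdd]
  have c1 : signedColumn X (Fin.natAdd p j) ∉ selectedSpan X i := by
    rw [signedColumn_natAdd]; simpa using hj
  have t0 := hθ (Fin.castAdd p j) fun l h => c0 (h ▸ hmem l)
  have t1 := hθ (Fin.natAdd p j) fun l h => c1 (h ▸ hmem l)
  have r0 := mt (hi.residual_eq_zero_iff _).1 c0
  have r1 := mt (hi.residual_eq_zero_iff _).1 c1
  have e : residual X i (Fin.natAdd p j) = -residual X i (Fin.castAdd p j) := by
    refine hi.residual_eq _ ?_ (Submodule.neg_mem _ (hi.residual_mem_orthogonal _))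
    have := Submodule.neg_mem _ (sub_residual_mem X i (Fin.castAdd p j))
    rw [signedColumn_castAdd] at this
    rw [signedColumn_natAdd]
    convert this using 1
    abel
  have z0 := mt (hy k i _ (Fin.castAdd p j)).2 (frozenVec_ne_zero r0 t0)
  have f0 := frozenZ_mul (y := y) t0
  have f1 := frozenZ_mul (y := y) t1
  rw [e, inner_neg_left, ← f0] at f1
  rcases lt_or_gt_of_ne z0 with h | h
  · refine ⟨_, t1, ?_⟩
    have : 0 < frozenZ X y i (Fin.natAdd p j) * (1 - theta X i (Fin.natAdd p j)) := by
      rw [f1]; nlinarith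
    exact pos_of_mul_pos_left this (by linarith)
  · exact ⟨_, t0, h⟩

/-- The first `k` terms of a sequence of signed variables. -/
abbrev pre (q : ℕ → Fin (p + p)) (k : ℕ) : Fin k → Fin (p + p) := fun l => q l

lemma snocVar_pre (q : ℕ → Fin (p + p)) (k : ℕ) : snocVar (pre q k) (q k) = pre q (k + 1) := by
  ext1 l
  refine Fin.lastCases ?_ (fun l => ?_) l <;> simp [snocVar, pre]

lemma larPath_eq_pre [NeZero p] (k : ℕ) :
    larPath X y k = pre (fun l => larIndex X y (l + 1)) k := by
  induction k with
  | zero => exact Subsingleton.elim _ _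
  | succ k ih => rw [← snocVar_pre, ← ih]; rfl

lemma larPath_eq_pre_iff [NeZero p] {q : ℕ → Fin (p + p)} {k : ℕ} :
    larPath X y k = pre q k ↔ ∀ l < k, nextIndex X y (pre q l) = q l := by
  induction k with
  | zero => simp [Subsingleton.elim (larPath X y 0) (pre q 0)]
  | succ k ih =>
    rw [← snocVar_pre, larPath, Fin.snoc_inj, ih, Nat.forall_lt_succ_right]
    refine and_congr_right fun h => ?_
    rw [ih.2 h]

lemma Independent.pre_mono {q : ℕ → Fin (p + p)} {k l : ℕ} (h : Independent X (pre q l))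
    (hkl : k ≤ l) : Independent X (pre q k) :=
  LinearIndependent.comp h (Fin.castLE hkl) (Fin.castLE_injective hkl)

lemma Independent.residual_ne_zero {q : ℕ → Fin (p + p)} {k : ℕ}
    (h : Independent X (pre q (k + 1))) : residual X (pre q k) (q k) ≠ 0 := by
  intro h0
  rw [(h.pre_mono k.le_succ).residual_eq_zero_iff, selectedSpan_eq_span_signedColumn] at h0
  have e : Fin.snoc (α := fun _ => EuclideanSpace ℝ (Fin n)) (fun l => signedColumn X (pre q k l))
      (signedColumn X (q k)) = fun l => signedColumn X (pre q (k + 1) l) := by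
    ext1 l
    refine Fin.lastCases ?_ (fun l => ?_) l <;> simp [pre]
  have h' : LinearIndependent ℝ fun l => signedColumn X (pre q (k + 1) l) := h
  rw [← e] at h'
  exact (linearIndependent_finSnoc.1 h').2 h0

variable (X) in
/-- The sequence `q` satisfies the Irrepresentable Check up to `K` and its first `K` columns are
linearly independent. -/
structure Regular (K : ℕ) (q : ℕ → Fin (p + p)) : Prop where
  rank : K < X.rank
  theta_lt : ∀ k ≤ K, ∀ j, (∀ l < k, j ≠ q l) → theta X (pre q k) j < 1
  independent : Independent X (pre q K)

lemma IrrepresentableCheck.theta_lt {K : ℕ} {q : ℕ → Fin (p + p)}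
    (h : IrrepresentableCheck X (pre q K)) (k : ℕ) (hk : k ≤ K) (j : Fin (p + p))
    (hj : ∀ l < k, j ≠ q l) : theta X (pre q k) j < 1 := by
  rcases Nat.eq_zero_or_pos k with rfl | hk0
  · rw [theta_zero]; exact one_pos
  · exact h.2 k hk hk0 j fun l => hj l l.2

/-- The maximum is positive by `exists_frozenZ_pos`, whereas a column already in the span has zero
residual and zero frozen correlation. Hence the entering column is a new direction. -/
lemma path_step [NeZero p] {K : ℕ} (hK : K < X.rank) (hy : Generic X y)
    (h : IrrepresentableCheck X (larPath X y K)) {k : ℕ} (hk : k ≤ K)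
    (hi : Independent X (larPath X y k)) :
    theta X (larPath X y k) (larIndex X y (k + 1)) < 1 ∧
      residual X (larPath X y k) (larIndex X y (k + 1)) ≠ 0 := by
  rw [larPath_eq_pre] at h
  obtain ⟨j, hj, hpos⟩ := exists_frozenZ_pos hi (hk.trans_lt hK) (fun j hj => by
    rw [larPath_eq_pre] at hj ⊢
    exact h.theta_lt k hk j fun l hl => hj ⟨l, hl⟩) hy
  have hm := mem_maximizers.1 (nextIndex_mem (maximizers_nonempty (y := y) hj))
  refine ⟨hm.1, fun h0 => ?_⟩
  have h1 := hm.2 j hj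
  have h2 : frozenZ X y (larPath X y k) (nextIndex X y (larPath X y k)) = 0 := by
    rw [frozenZ_eq_inner, frozenVec]
    have : residual X (larPath X y k) (nextIndex X y (larPath X y k)) = 0 := h0
    rw [this]; simp
  linarith

lemma path_independent [NeZero p] {K : ℕ} (hK : K < X.rank) (hy : Generic X y)
    (h : IrrepresentableCheck X (larPath X y K)) {k : ℕ} (hk : k ≤ K + 1) :
    Independent X (larPath X y k) := by
  induction k with
  | zero => exact linearIndependent_empty_type
  | succ k ih =>
    have hi := ih (by omega)
    exact hi.snocVar (path_step hK hy h (by omega) hi).2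

variable {K : ℕ} {q : ℕ → Fin (p + p)}

/-- The selected variables have `θ = 1` and the check covers all others. The competitors at step `k
+ 1` are therefore those at step `k` without `q k`. -/
lemma Regular.theta_lt_iff (hq : Regular X K q) {k : ℕ} (hk : k ≤ K) {j : Fin (p + p)} :
    theta X (pre q k) j < 1 ↔ ∀ l < k, j ≠ q l := by
  refine ⟨fun h l hl hj => ?_, hq.theta_lt k hk j⟩
  have : theta X (pre q k) (q l) = 1 := (hq.independent.pre_mono hk).theta_self ⟨l, hl⟩
  rw [← hj] at this
  linarith

lemma Regular.theta_self_lt (hq : Regular X K q) {k : ℕ} (hk : k < K) :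
    theta X (pre q k) (q k) < 1 := by
  refine hq.theta_lt k hk.le _ fun l hl he => ?_
  have h : Function.Injective fun l => signedColumn X (pre q K l) := hq.independent.injective
  have := @h ⟨k, hk⟩ ⟨l, hl.trans hk⟩ (by simp [he])
  simp at this
  omega

lemma Regular.exists_theta_lt (hq : Regular X K q) {k : ℕ} (hk : k ≤ K) :
    ∃ j, theta X (pre q k) j < 1 := by
  obtain ⟨j, hj⟩ := exists_column_notMem (pre q k) (hk.trans_lt hq.rank)
  refine ⟨Fin.castAdd p j, hq.theta_lt k hk _ fun l hl h => hj ?_⟩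
  rw [← signedColumn_castAdd, h, selectedSpan_eq_span_signedColumn]
  exact Submodule.subset_span ⟨⟨l, hl⟩, rfl⟩

lemma Regular.frozenZ_cmp (hq : Regular X K q) {k : ℕ} (hk : k < K) {j : Fin (p + p)}
    (hj : theta X (pre q (k + 1)) j < 1) (y : EuclideanSpace ℝ (Fin n)) :
    (frozenZ X y (pre q (k + 1)) j ≤ frozenZ X y (pre q k) (q k) ↔
      frozenZ X y (pre q k) j ≤ frozenZ X y (pre q k) (q k)) := by
  have h1 : theta X (pre q k) j < 1 := by
    rw [hq.theta_lt_iff hk.le]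
    rw [hq.theta_lt_iff (k := k + 1) hk] at hj
    exact fun l hl => hj l (by omega)
  have hi := hq.independent.pre_mono (k := k + 1) hk
  rw [← snocVar_pre] at hj ⊢
  exact ((hi.pre_mono k.le_succ).frozenZ_snocVar_cmp j hi.residual_ne_zero (hq.theta_self_lt hk)
    h1 hj y)

/-- The variable `q k` is the next one to enter after `q 0, …, q (k - 1)` iff the knot that follows
`q 0, …, q k` is at most the frozen correlation of `q k`. -/
lemma Regular.nextIndex_eq_iff [NeZero p] (hq : Regular X K q) (hy : Generic X y) {k : ℕ} (hk : k < K) :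
    nextIndex X y (pre q k) = q k ↔
      nextKnot X y (pre q (k + 1)) ≤ frozenZ X y (pre q k) (q k) := by
  obtain ⟨j₀, hj₀⟩ := hq.exists_theta_lt (k := k + 1) hk
  have : Nonempty {j : Fin (p + p) // theta X (pre q (k + 1)) j < 1} := ⟨⟨j₀, hj₀⟩⟩
  have hθ := hq.theta_self_lt hk
  have hi := hq.independent.pre_mono (k := k + 1) hk
  constructor
  · intro h
    have hm := nextIndex_mem (maximizers_nonempty (y := y) hθ)
    rw [h, mem_maximizers] at hm
    refine ciSup_le fun j => (hq.frozenZ_cmp hk j.2 y).2 (hm.2 _ ?_)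
    have := j.2
    rw [hq.theta_lt_iff hk] at this
    exact (hq.theta_lt_iff hk.le).2 fun l hl => this l (by omega)
  · intro h
    have key : ∀ l, theta X (pre q k) l < 1 → l ≠ q k → theta X (pre q (k + 1)) l < 1 := by
      intro l hl hlk
      rw [hq.theta_lt_iff hk]
      rw [hq.theta_lt_iff hk.le] at hl
      intro l' hl'
      rcases Nat.lt_succ_iff_lt_or_eq.1 hl' with h' | rfl
      · exact hl l' h'
      · exact hlk
    have hmax : q k ∈ maximizers X y (pre q k) := by
      refine mem_maximizers.2 ⟨hθ, fun l hl => ?_⟩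
      by_cases hlk : l = q k
      · rw [hlk]
      · exact (hq.frozenZ_cmp hk (key l hl hlk) y).1 ((le_nextKnot (key l hl hlk)).trans h)
    have hm := nextIndex_mem (maximizers_nonempty (y := y) hθ)
    set m := nextIndex X y (pre q k)
    by_contra hne
    have hm' := mem_maximizers.1 hm
    -- A tie between `q k` and another maximizer `m`: genericity makes their frozen vectors equal,
    -- so the residual of `m` is a multiple of that of `q k`. Adding `q k` then brings `θ_m` to
    -- exactly `1`, against `hlt`.
    have hlt := key m hm'.1 hne
    have hv := (hy _ _ _ _).1 ((nextKnot_eq hm).symm.trans (nextKnot_eq hmax))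
    have hr := hi.residual_ne_zero
    have hik := hi.pre_mono k.le_succ
    rw [← snocVar_pre, hik.theta_snocVar m hr] at hlt
    have hs : ⟪residual X (pre q k) (q k), residual X (pre q k) m⟫
        = ⟪residual X (pre q k) (q k), signedColumn X m⟫ := by
      have := (Submodule.mem_orthogonal' _ _).1 (hik.residual_mem_orthogonal (q k)) _
        (sub_residual_mem X _ m)
      rw [inner_sub_right, sub_eq_zero] at this
      exact this.symm
    have h1 : residual X (pre q k) m
        = ((1 - theta X (pre q k) m) / (1 - theta X (pre q k) (q k))) • residual X (pre q k) (q k) := by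
      have hne : 1 - theta X (pre q k) m ≠ 0 := by linarith [hm'.1]
      have : residual X (pre q k) m = (1 - theta X (pre q k) m) • frozenVec X (pre q k) m := by
        rw [frozenVec, smul_smul, mul_inv_cancel₀ hne, one_smul]
      rw [this, hv, frozenVec, smul_smul, div_eq_mul_inv]
    have hn : ‖residual X (pre q k) (q k)‖ ^ 2 ≠ 0 := by simpa using hr
    rw [← hs, h1, real_inner_smul_right, real_inner_self_eq_norm_sq, mul_div_assoc, div_self hn,
      mul_one, mul_div_cancel₀] at hlt
    · linarith
    · linarith

variable (X K q y) in
/-- The knots, as functions of the observation, along the path `q`. -/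
def knotSeq : ℕ → EReal
  | 0 => ⊤
  | k + 1 => if k < K then ((frozenZ X y (pre q k) (q k) : ℝ) : EReal)
      else ((nextKnot X y (pre q K) : ℝ) : EReal)

variable (X K q y) in
/-- The signed variables, as functions of the observation, along the path `q`. -/
def indexSeq [NeZero p] (l : ℕ) : Fin (p + p) := if l < K then q l else nextIndex X y (pre q K)

lemma nextKnot_eq_frozenZ [NeZero p] (hq : Regular X K q) {k : ℕ} (hk : k < K)
    (h : nextIndex X y (pre q k) = q k) :
    nextKnot X y (pre q k) = frozenZ X y (pre q k) (q k) := by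
  have := nextKnot_eq (nextIndex_mem (maximizers_nonempty (y := y) (hq.theta_self_lt hk)))
  rwa [h] at this

/-- The path starts with `q` iff the knots along `q` are non-increasing. -/
theorem Regular.larPath_eq_iff [NeZero p] (hq : Regular X K q) (hy : Generic X y) :
    larPath X y K = pre q K ↔ ∀ k ≤ K, knotSeq X y K q (k + 1) ≤ knotSeq X y K q k := by
  rw [larPath_eq_pre_iff]
  constructor
  · intro h k hk
    rcases k with _ | k
    · exact le_top
    have h1 := (hq.nextIndex_eq_iff hy (k := k) hk).1 (h k hk)
    have hkK : k < K := hk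
    simp only [knotSeq, hkK, if_true]
    split_ifs with h2
    · rw [EReal.coe_le_coe_iff, ← nextKnot_eq_frozenZ hq h2 (h _ h2)]
      exact h1
    · obtain rfl : k + 1 = K := by omega
      exact EReal.coe_le_coe_iff.2 h1
  · intro h
    -- Downward induction from `K`. Once the maximum following `q 0, …, q k` is known to be the knot
    -- of index `k + 2` along `q`, the monotonicity hypothesis says that `q k` wins at step `k`,
    -- which identifies the preceding maximum in turn.
    have key : ∀ d k, k + d = K →
        ((nextKnot X y (pre q k) : ℝ) : EReal) = knotSeq X y K q (k + 1) ∧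
        ∀ l, k ≤ l → l < K → nextIndex X y (pre q l) = q l := by
      intro d
      induction d with
      | zero =>
        rintro k rfl
        exact ⟨by simp [knotSeq], fun l h1 h2 => absurd h1 (by omega)⟩
      | succ d ih =>
        intro k hk
        have hkK : k < K := by omega
        obtain ⟨h1, h2⟩ := ih (k + 1) (by omega)
        have h3 := h (k + 1) hkK
        have h4 : knotSeq X y K q (k + 1) = ((frozenZ X y (pre q k) (q k) : ℝ) : EReal) := by
          simp [knotSeq, hkK]
        rw [← h1, h4, EReal.coe_le_coe_iff] at h3
        have h5 := (hq.nextIndex_eq_iff hy hkK).2 h3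
        refine ⟨by rw [h4, nextKnot_eq_frozenZ hq hkK h5], fun l hl hlK => ?_⟩
        rcases hl.eq_or_lt with rfl | hl
        · exact h5
        · exact h2 l hl hlK
    exact fun l hl => (key K 0 (by omega)).2 l (by omega) hl

lemma larIndex_eq_indexSeq [NeZero p] (h : larPath X y K = pre q K) {l : ℕ} (hl : l ≤ K) :
    larIndex X y (l + 1) = indexSeq X y K q l := by
  have h' := larPath_eq_pre_iff.1 h
  rw [indexSeq]
  split_ifs with hlK
  · rw [larIndex, Nat.add_sub_cancel, larPath_eq_pre_iff.2 fun m hm => h' m (hm.trans hlK)]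
    exact h' l hlK
  · obtain rfl : l = K := by omega
    rw [larIndex, Nat.add_sub_cancel, h]

lemma larPath_succ_eq [NeZero p] (h : larPath X y K = pre q K) :
    larPath X y (K + 1) = pre (indexSeq X y K q) (K + 1) := by
  rw [larPath_eq_pre]
  ext1 l
  exact larIndex_eq_indexSeq h (by omega)

lemma Regular.larKnot_eq_knotSeq [NeZero p] (hq : Regular X K q) (h : larPath X y K = pre q K)
    {k : ℕ} (hk : k ≤ K + 1) : larKnot X y k = knotSeq X y K q k := by
  rcases k with _ | k
  · rfl
  have h' := larPath_eq_pre_iff.1 h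
  rw [larKnot, knotSeq]
  split_ifs with hkK
  · rw [larPath_eq_pre_iff.2 fun m hm => h' m (hm.trans hkK), nextKnot_eq_frozenZ hq hkK (h' k hkK)]
  · obtain rfl : k = K := by omega
    rw [h]

end Path

/-! ### Isotropic Gaussian vectors -/

section Gaussian

variable {n : ℕ} (β : EuclideanSpace ℝ (Fin n)) (σ : ℝ)

/-- The Gaussian law with mean `β` and covariance `σ² Id`. -/
abbrev isoGaussian : Measure (EuclideanSpace ℝ (Fin n)) :=
  multivariateGaussian β (σ ^ 2 • (1 : Matrix (Fin n) (Fin n) ℝ))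

lemma covariance_inner_isoGaussian (x y : EuclideanSpace ℝ (Fin n)) :
    cov[fun z => ⟪x, z⟫, fun z => ⟪y, z⟫; isoGaussian β σ] = σ ^ 2 * ⟪x, y⟫ := by
  rw [← covarianceBilin_apply_eq_cov IsGaussian.memLp_two_id, covarianceBilin_multivariateGaussian
    (Matrix.PosSemidef.one.smul (sq_nonneg σ)), Matrix.smul_mulVec, Matrix.one_mulVec,
    dotProduct_smul, smul_eq_mul]
  simp [PiLp.inner_apply, dotProduct, mul_comm]

lemma map_inner_isoGaussian (x : EuclideanSpace ℝ (Fin n)) :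
    (isoGaussian β σ).map (fun z => ⟪x, z⟫) = gaussianReal ⟪x, β⟫ ((σ * ‖x‖) ^ 2).toNNReal := by
  have h := IsGaussian.map_eq_gaussianReal (μ := isoGaussian β σ) (innerSL ℝ x)
  have e : (⇑(innerSL ℝ x) : EuclideanSpace ℝ (Fin n) → ℝ) = fun z => ⟪x, z⟫ := rfl
  have e2 : ∫ z, innerSL ℝ x z ∂(isoGaussian β σ) = ⟪x, β⟫ := by
    rw [(innerSL ℝ x).integral_comp_comm (φ := fun z => z) IsGaussian.integrable_fun_id,
      integral_id_multivariateGaussian]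
    rfl
  rw [e2, e, ← covariance_self (by fun_prop),
    covariance_inner_isoGaussian, real_inner_self_eq_norm_sq, ← mul_pow] at h
  exact h

lemma ae_inner_ne_zero {σ : ℝ} (hσ : σ ≠ 0) {x : EuclideanSpace ℝ (Fin n)} (hx : x ≠ 0) :
    ∀ᵐ z ∂(isoGaussian β σ), ⟪x, z⟫ ≠ 0 := by
  have hv : ((σ * ‖x‖) ^ 2).toNNReal ≠ 0 :=
    toNNReal_sq_ne_zero (mul_ne_zero hσ (norm_ne_zero_iff.2 hx))
  have := nullSingletonClass_gaussianReal (μ := ⟪x, β⟫) hv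
  have h : ∀ᵐ r ∂((isoGaussian β σ).map (fun z => ⟪x, z⟫)), r ≠ 0 := by
    rw [map_inner_isoGaussian]
    exact Measure.ae_ne _ 0
  exact ae_of_ae_map (f := fun z => ⟪x, z⟫) (by fun_prop) h

/-- There are countably many conditions, each excluding the zero set of a nonzero linear form, which
is null for a nondegenerate Gaussian law. -/
lemma ae_generic {p : ℕ} (X : Matrix (Fin n) (Fin p) ℝ) {σ : ℝ} (hσ : σ ≠ 0) :
    ∀ᵐ y ∂(isoGaussian β σ), Generic X y := by
  simp only [Generic, ae_all_iff, Filter.eventually_and]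
  intro k i l m
  constructor
  · by_cases h : frozenVec X i l = frozenVec X i m
    · simp [h]
    · filter_upwards [ae_inner_ne_zero β hσ (sub_ne_zero.2 h)] with y hy hy'
      rw [frozenZ_eq_inner, frozenZ_eq_inner, ← sub_eq_zero, ← inner_sub_left] at hy'
      exact absurd hy' hy
  · by_cases h : frozenVec X i l = 0
    · simp [h]
    · filter_upwards [ae_inner_ne_zero β hσ h] with y hy hy'
      rw [frozenZ_eq_inner] at hy'
      exact absurd hy' hy

/-- The coordinates of an isotropic Gaussian vector along orthogonal directions, along which its
mean vanishes, are independent centered Gaussian variables, independent of its projection on the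
orthogonal complement. -/
lemma map_projection_prod_coords {m : ℕ} (u : Fin m → EuclideanSpace ℝ (Fin n))
    (hu : ∀ k l, k ≠ l → ⟪u k, u l⟫ = 0) (hβ : ∀ k, ⟪u k, β⟫ = 0) :
    (isoGaussian β σ).map (fun y =>
      ((Submodule.span ℝ (Set.range u))ᗮ.starProjection y, fun k => ⟪u k, y⟫))
      = ((isoGaussian β σ).map (Submodule.span ℝ (Set.range u))ᗮ.starProjection).prod
        (Measure.pi fun k => gaussianReal 0 ((σ * ‖u k‖) ^ 2).toNNReal) := by
  set P := (Submodule.span ℝ (Set.range u))ᗮ.starProjection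
  let V : EuclideanSpace ℝ (Fin n) →L[ℝ] (Fin m → ℝ) :=
    ContinuousLinearMap.pi fun k => innerSL ℝ (u k)
  have hid : HasGaussianLaw (id : EuclideanSpace ℝ (Fin n) → _) (isoGaussian β σ) :=
    ⟨by rw [Measure.map_id]; infer_instance⟩
  have hPV : HasGaussianLaw (fun y => (P y, V y)) (isoGaussian β σ) := hid.map (P.prod V)
  have hV : HasGaussianLaw (fun y => (V y : Fin m → ℝ)) (isoGaussian β σ) := hid.map V
  -- The pair is jointly Gaussian, so uncorrelated linear functionals suffice: a functional of `P y`
  -- is represented by a vector of the orthogonal complement, one of `V y` by a vector of the span.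
  have hind : IndepFun (fun y => P y) (fun y => V y) (isoGaussian β σ) := by
    refine hPV.indepFun_of_covariance_strongDual fun L₁ L₂ => ?_
    have e1 : L₁ ∘ (fun y => P y) = fun y => ⟪P ((InnerProductSpace.toDual ℝ _).symm L₁), y⟫ := by
      ext y
      rw [Submodule.inner_starProjection_left_eq_right, InnerProductSpace.toDual_symm_apply]
      rfl
    have e2 : L₂ ∘ (fun y => V y) = fun y => ⟪∑ k, L₂ (Pi.single k 1) • u k, y⟫ := by
      ext y
      rw [sum_inner]
      have : (V y : Fin m → ℝ) = ∑ k, ⟪u k, y⟫ • Pi.single k 1 := by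
        ext k
        simp [V, Finset.sum_apply, Pi.single_apply]
      simp [this, real_inner_smul_left, mul_comm]
    rw [e1, e2, covariance_inner_isoGaussian]
    have h1 : (P ((InnerProductSpace.toDual ℝ _).symm L₁)) ∈ (Submodule.span ℝ (Set.range u))ᗮ :=
      Submodule.starProjection_apply_mem _ _
    have h2 : ∑ k, L₂ (Pi.single k 1) • u k ∈ Submodule.span ℝ (Set.range u) :=
      Submodule.sum_mem _ fun k _ => Submodule.smul_mem _ _ (Submodule.subset_span ⟨k, rfl⟩)
    rw [(Submodule.mem_orthogonal' _ _).1 h1 _ h2, mul_zero]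
  have hiind : iIndepFun (fun k y => ⟪u k, y⟫) (isoGaussian β σ) := by
    refine hV.iIndepFun_of_covariance_eq_zero (X := fun k y => ⟪u k, y⟫) fun k l hkl => ?_
    rw [covariance_inner_isoGaussian, hu k l hkl, mul_zero]
  have h1 := (indepFun_iff_map_prod_eq_prod_map_map (by fun_prop) (by fun_prop)).1 hind
  have h2 := (iIndepFun_iff_map_fun_eq_pi_map (fun k => by fun_prop)).1 hiind
  refine h1.trans ?_
  congr 1
  refine h2.trans ?_
  congr 1
  ext1 k
  rw [map_inner_isoGaussian, hβ]

end Gaussian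

/-! ### The orthogonal directions of the knots and what their removal leaves unchanged -/

section Directions

variable {n p : ℕ} {X : Matrix (Fin n) (Fin p) ℝ} {K : ℕ} {q : ℕ → Fin (p + p)}

lemma selectedSpan_pre_mono {k l : ℕ} (h : k ≤ l) :
    selectedSpan X (pre q k) ≤ selectedSpan X (pre q l) := by
  refine Submodule.span_mono ?_
  rintro _ ⟨m, rfl⟩
  exact ⟨Fin.castLE h m, rfl⟩

lemma frozenVec_mem_orthogonal {k : ℕ} {i : Fin k → Fin (p + p)} (h : Independent X i)
    (j : Fin (p + p)) : frozenVec X i j ∈ (selectedSpan X i)ᗮ :=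
  Submodule.smul_mem _ _ (h.residual_mem_orthogonal j)

variable (X q) in
/-- The vector representing the linear form whose value is the `k`-th frozen correlation along
the path `q`. -/
def direction (k : ℕ) : EuclideanSpace ℝ (Fin n) := frozenVec X (pre q k) (q k)

variable (q) in
-- The direction of index `k` involves only the first `k + 1` columns; combined with its
-- orthogonality to the first `k`, this gives the mutual orthogonality of the directions.
lemma direction_mem {k l : ℕ} (h : k < l) : direction X q k ∈ selectedSpan X (pre q l) := by
  refine selectedSpan_pre_mono (k := k + 1) h ?_
  have h1 := selectedSpan_snocVar (X := X) (i := pre q k) (q k)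
  rw [snocVar_pre] at h1
  refine Submodule.smul_mem _ _ ?_
  simpa using Submodule.sub_mem _ h1.2 (h1.1 (sub_residual_mem X (pre q k) (q k)))

lemma Regular.direction_mem_orthogonal (hq : Regular X K q) {k : ℕ} (hk : k ≤ K) :
    direction X q k ∈ (selectedSpan X (pre q k))ᗮ :=
  frozenVec_mem_orthogonal (hq.independent.pre_mono hk) _

lemma Regular.inner_direction (hq : Regular X K q) {k l : ℕ} (hk : k ≤ K) (hl : l ≤ K)
    (hkl : k ≠ l) : ⟪direction X q k, direction X q l⟫ = 0 := by
  rcases lt_or_gt_of_ne hkl with h | h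
  · exact (Submodule.mem_orthogonal _ _).1 (hq.direction_mem_orthogonal hl) _ (direction_mem q h)
  · exact (Submodule.mem_orthogonal' _ _).1 (hq.direction_mem_orthogonal hk) _ (direction_mem q h)

variable (X q) in
/-- The projection which removes the components along the directions of index
`a, …, a + g - 1`. -/
def outerProj (a g : ℕ) : EuclideanSpace ℝ (Fin n) →L[ℝ] EuclideanSpace ℝ (Fin n) :=
  (Submodule.span ℝ (Set.range fun k : Fin g => direction X q (a + k)))ᗮ.starProjection

lemma sub_outerProj_mem (a g : ℕ) (y : EuclideanSpace ℝ (Fin n)) :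
    y - outerProj X q a g y ∈
      Submodule.span ℝ (Set.range fun k : Fin g => direction X q (a + k)) := by
  have h := Submodule.sub_starProjection_mem_orthogonal (K := (Submodule.span ℝ (Set.range fun k : Fin g => direction X q (a + k)))ᗮ) y
  rwa [Submodule.orthogonal_orthogonal] at h

lemma inner_outerProj (a g : ℕ) {v : EuclideanSpace ℝ (Fin n)}
    (hv : ∀ k : Fin g, ⟪v, direction X q (a + k)⟫ = 0) (y : EuclideanSpace ℝ (Fin n)) :
    ⟪v, outerProj X q a g y⟫ = ⟪v, y⟫ := by
  have h : v ∈ (Submodule.span ℝ (Set.range fun k : Fin g => direction X q (a + k)))ᗮ := by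
    rw [Submodule.mem_orthogonal']
    intro u hu
    induction hu using Submodule.span_induction with
    | mem x hx => obtain ⟨m, rfl⟩ := hx; exact hv m
    | zero => simp
    | add x y _ _ hx hy => rw [inner_add_right, hx, hy, add_zero]
    | smul c x _ hx => rw [inner_smul_right, hx, mul_zero]
  have := (Submodule.mem_orthogonal' _ _).1 h _ (sub_outerProj_mem a g y)
  rw [inner_sub_right, sub_eq_zero] at this
  exact this.symm

lemma inner_outerProj_of_orthogonal {a g : ℕ} (hg : a + g ≤ K) {v : EuclideanSpace ℝ (Fin n)}
    (hv : v ∈ (selectedSpan X (pre q K))ᗮ) (y : EuclideanSpace ℝ (Fin n)) :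
    ⟪v, outerProj X q a g y⟫ = ⟪v, y⟫ :=
  inner_outerProj a g (fun k =>
    (Submodule.mem_orthogonal' _ _).1 hv _ (direction_mem q (by omega))) y

lemma Regular.frozenZ_outerProj (hq : Regular X K q) {a g : ℕ} (hg : a + g ≤ K) {l : ℕ} (hl : l < K)
    (hla : l < a ∨ a + g ≤ l) (y : EuclideanSpace ℝ (Fin n)) :
    frozenZ X (outerProj X q a g y) (pre q l) (q l) = frozenZ X y (pre q l) (q l) := by
  rw [frozenZ_eq_inner, frozenZ_eq_inner]
  exact inner_outerProj a g (fun k => hq.inner_direction hl.le (by omega) (by omega)) y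

lemma Regular.frozenZ_outerProj_last (hq : Regular X K q) {a g : ℕ} (hg : a + g ≤ K)
    (y : EuclideanSpace ℝ (Fin n)) (j : Fin (p + p)) :
    frozenZ X (outerProj X q a g y) (pre q K) j = frozenZ X y (pre q K) j := by
  rw [frozenZ_eq_inner, frozenZ_eq_inner]
  exact inner_outerProj_of_orthogonal hg (frozenVec_mem_orthogonal hq.independent j) y

lemma Regular.nextKnot_outerProj (hq : Regular X K q) {a g : ℕ} (hg : a + g ≤ K)
    (y : EuclideanSpace ℝ (Fin n)) :
    nextKnot X (outerProj X q a g y) (pre q K) = nextKnot X y (pre q K) := by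
  simp [nextKnot, hq.frozenZ_outerProj_last hg]

lemma Regular.indexSeq_outerProj [NeZero p] (hq : Regular X K q) {a g : ℕ} (hg : a + g ≤ K)
    (y : EuclideanSpace ℝ (Fin n)) :
    indexSeq X (outerProj X q a g y) K q = indexSeq X y K q := by
  have : maximizers X (outerProj X q a g y) (pre q K) = maximizers X y (pre q K) := by
    ext m; simp [mem_maximizers, hq.frozenZ_outerProj_last hg]
  ext1 l
  simp [indexSeq, nextIndex, this]

/-- Directions are numbered from `0` and knots from `1`: removing the directions `a, …, a + g - 1`
affects only the knots `a + 1, …, a + g`. -/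
lemma Regular.knotSeq_outerProj (hq : Regular X K q) {a g : ℕ} (hg : a + g ≤ K)
    (y : EuclideanSpace ℝ (Fin n)) {k : ℕ} (hk : k ≤ a ∨ a + g < k) :
    knotSeq X (outerProj X q a g y) K q k = knotSeq X y K q k := by
  rcases k with _ | k
  · rfl
  rw [knotSeq, knotSeq, hq.nextKnot_outerProj hg]
  split_ifs with h
  · rw [hq.frozenZ_outerProj hg h (by omega)]
  · rfl

lemma selectSpace_le_orthogonal {k : ℕ} (i : Fin k → Fin (p + p)) (n₁ : ℕ) :
    selectSpace X i n₁ ≤ (selectedSpan X i)ᗮ := by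
  rintro _ ⟨v, _, rfl⟩
  exact Submodule.starProjection_apply_mem _ _

variable (X) in
/-- The estimator of the standard deviation, when the signed variables `i` are selected. -/
def sigmaOf (n₁ : ℕ) {k : ℕ} (i : Fin k → Fin (p + p)) (y : EuclideanSpace ℝ (Fin n)) : ℝ :=
  ‖(selectSpace X i n₁).starProjection y‖ / Real.sqrt n₁

lemma sigmaSelect_eq_sigmaOf [NeZero p] (y : EuclideanSpace ℝ (Fin n)) (n₁ : ℕ) :
    sigmaSelect X K n₁ y = sigmaOf X n₁ (larPath X y (K + 1)) y := rfl

variable (X K q) in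
/-- The estimator of the standard deviation along the path `q`. -/
def sigmaSeq [NeZero p] (n₁ : ℕ) (y : EuclideanSpace ℝ (Fin n)) : ℝ :=
  sigmaOf X n₁ (pre (indexSeq X y K q) (K + 1)) y

lemma sigmaSelect_eq_sigmaSeq [NeZero p] {y : EuclideanSpace ℝ (Fin n)}
    (h : larPath X y K = pre q K) (n₁ : ℕ) : sigmaSelect X K n₁ y = sigmaSeq X K q n₁ y := by
  rw [sigmaSelect_eq_sigmaOf, larPath_succ_eq h, sigmaSeq]

/-- The space `E₁` is orthogonal to `H_{K+1}`, hence to `H_K`, which contains every removed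
direction; the variable selecting `E₁` at step `K + 1` is unchanged too. -/
lemma Regular.sigmaSeq_outerProj [NeZero p] (hq : Regular X K q) {a g : ℕ} (hg : a + g ≤ K) (n₁ : ℕ)
    (y : EuclideanSpace ℝ (Fin n)) :
    sigmaSeq X K q n₁ (outerProj X q a g y) = sigmaSeq X K q n₁ y := by
  rw [sigmaSeq, sigmaSeq, hq.indexSeq_outerProj hg, sigmaOf, sigmaOf]
  congr 2
  rw [← sub_eq_zero, ← map_sub, Submodule.starProjection_apply_eq_zero_iff,
    Submodule.mem_orthogonal']
  intro u hu
  have h1 := selectSpace_le_orthogonal _ _ hu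
  have h2 : u ∈ (selectedSpan X (pre q K))ᗮ := by
    refine Submodule.orthogonal_le ?_ h1
    refine (selectedSpan_pre_mono (q := indexSeq X y K q) K.le_succ).trans' (le_of_eq ?_)
    congr 1
    ext1 l
    simp [pre, indexSeq]
  rw [inner_sub_left, sub_eq_zero, real_inner_comm, inner_outerProj_of_orthogonal hg h2,
    real_inner_comm]

end Directions

/-! ### Measurability of the path, the knots and the estimator -/

section Measurability

variable {n p : ℕ} {X : Matrix (Fin n) (Fin p) ℝ} {K : ℕ} {q : ℕ → Fin (p + p)}

lemma measurable_frozenZ {k : ℕ} (i : Fin k → Fin (p + p)) (j : Fin (p + p)) :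
    Measurable fun y => frozenZ X y i j := by
  simp_rw [frozenZ_eq_inner]
  fun_prop

lemma measurable_nextKnot {k : ℕ} (i : Fin k → Fin (p + p)) :
    Measurable fun y => nextKnot X y i :=
  Measurable.iSup fun j => measurable_frozenZ i j

lemma measurable_nextIndex [NeZero p] {k : ℕ} (i : Fin k → Fin (p + p)) :
    Measurable fun y => nextIndex X y i := by
  classical
  let _ : MeasurableSpace (Finset (Fin (p + p))) := ⊤
  have h : Measurable fun y => maximizers X y i := by
    refine measurable_to_countable' fun s => ?_
    have e : (fun y => maximizers X y i) ⁻¹' {s} = ⋂ m, {y | m ∈ maximizers X y i ↔ m ∈ s} := by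
      ext y; simp [Finset.ext_iff]
    rw [e]
    refine MeasurableSet.iInter fun m => ?_
    have hm : MeasurableSet {y | m ∈ maximizers X y i} := by
      have e2 : {y | m ∈ maximizers X y i} = {_y | theta X i m < 1} ∩
          ⋂ l, ⋂ _ : theta X i l < 1, {y | frozenZ X y i l ≤ frozenZ X y i m} := by
        ext y; simp [mem_maximizers]
      rw [e2]
      refine MeasurableSet.inter (MeasurableSet.const _) ?_
      exact MeasurableSet.iInter fun l => MeasurableSet.iInter fun _ =>
        measurableSet_le (measurable_frozenZ i l) (measurable_frozenZ i m)
    by_cases hs : m ∈ s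
    · simpa only [hs, iff_true] using hm
    · convert hm.compl using 1
      ext y; simp [hs]
  exact (measurable_from_top (f := fun s : Finset (Fin (p + p)) =>
    if h : s.Nonempty then s.min' h else Fin.castAdd p 0)).comp h

/-- The path takes countably many values, so measurability of a quantity computed along it reduces
to each fixed path. -/
lemma _root_.Measurable.apply_countable {α β γ : Type*} [MeasurableSpace α] [MeasurableSpace β]
    [MeasurableSpace γ] [Countable α] [MeasurableSingletonClass α] {f : α → β → γ} {g : β → α}
    (hg : Measurable g) (hf : ∀ x, Measurable (f x)) : Measurable fun y => f (g y) y :=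
  (measurable_from_prod_countable_right (f := fun z : α × β => f z.1 z.2) hf).comp
    (hg.prodMk measurable_id)

lemma measurable_larPath [NeZero p] (k : ℕ) : Measurable fun y => larPath X y k := by
  induction k with
  | zero => exact measurable_const
  | succ k ih =>
    refine ih.apply_countable (f := fun i y => snocVar i (nextIndex X y i)) fun i => ?_
    exact (measurable_of_countable (snocVar i)).comp (measurable_nextIndex i)

lemma measurable_larIndex [NeZero p] (k : ℕ) : Measurable fun y => larIndex X y k :=
  (measurable_larPath (k - 1)).apply_countable (f := fun i y => nextIndex X y i) measurable_nextIndex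

lemma measurable_larKnot [NeZero p] (k : ℕ) : Measurable fun y => larKnot X y k := by
  rcases k with _ | k
  · exact measurable_const
  exact ((measurable_larPath k).apply_countable (f := fun i y => nextKnot X y i)
    measurable_nextKnot).coe_real_ereal

lemma measurable_sigmaOf (n₁ : ℕ) {k : ℕ} (i : Fin k → Fin (p + p)) :
    Measurable (sigmaOf X n₁ i) := by
  unfold sigmaOf
  fun_prop

lemma measurable_sigmaSelect [NeZero p] (n₁ : ℕ) : Measurable (sigmaSelect X K n₁) :=
  (measurable_larPath (K + 1)).apply_countable (f := fun i => sigmaOf X n₁ i) (measurable_sigmaOf n₁)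

lemma measurable_knotSeq (k : ℕ) : Measurable fun y => knotSeq X y K q k := by
  rcases k with _ | k
  · exact measurable_const
  simp only [knotSeq]
  split_ifs
  · exact (measurable_frozenZ _ _).coe_real_ereal
  · exact (measurable_nextKnot _).coe_real_ereal

lemma measurable_indexSeq [NeZero p] (l : ℕ) : Measurable fun y => indexSeq X y K q l := by
  simp only [indexSeq]
  split_ifs
  · exact measurable_const
  · exact measurable_nextIndex _

lemma measurable_pre_indexSeq [NeZero p] (k : ℕ) :
    Measurable fun y => pre (indexSeq X y K q) k :=
  measurable_pi_lambda _ fun l => measurable_indexSeq l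

lemma measurable_sigmaSeq [NeZero p] (n₁ : ℕ) : Measurable (sigmaSeq X K q n₁) :=
  (measurable_pre_indexSeq (K + 1)).apply_countable (f := fun i => sigmaOf X n₁ i) (measurable_sigmaOf n₁)

end Measurability

/-! ### The numbers `ρ_k` as norms of directions -/

section Rho

variable {n p : ℕ} {X : Matrix (Fin n) (Fin p) ℝ}

variable (X) in
/-- The numbers `ρ_k` along the path `q`: the norms of the directions. -/
def rhoSeq (q : ℕ → Fin (p + p)) : ℕ → ℝ
  | 0 => 1
  | k + 1 => ‖direction X q k‖

lemma rhoSeq_congr {q q' : ℕ → Fin (p + p)} {k : ℕ} (h : ∀ l < k, q l = q' l) :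
    rhoSeq X q k = rhoSeq X q' k := by
  rcases k with _ | k
  · rfl
  have : pre q k = pre q' k := by
    ext1 l; exact h l (by omega)
  rw [rhoSeq, rhoSeq, direction, direction, this, h k (by omega)]

/-- The quantity under the root is the squared norm of the residual, because the fitted part is
orthogonal to it; `θ < 1` gives the denominator the right sign. -/
lemma Independent.norm_frozenVec {k : ℕ} {i : Fin k → Fin (p + p)} (h : Independent X i)
    {j : Fin (p + p)} (hj : theta X i j < 1) :
    Real.sqrt (gram X j j - regress X i j fun l => gram X j (i l)) / (1 - theta X i j)
      = ‖frozenVec X i j‖ := by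
  have h1 : gram X j j - regress X i j (fun l => gram X j (i l)) = ‖residual X i j‖ ^ 2 := by
    have h2 := (Submodule.mem_orthogonal' _ _).1 (h.residual_mem_orthogonal j) _
      (sub_residual_mem X i j)
    rw [inner_sub_right, sub_eq_zero, real_inner_self_eq_norm_sq] at h2
    rw [← h2, regress_eq_sum]
    nth_rewrite 1 [residual]
    rw [inner_sub_left, sum_inner, gram_eq_inner]
    congr 1
    refine Finset.sum_congr rfl fun l _ => ?_
    rw [real_inner_smul_left, gram_eq_inner, real_inner_comm]
  rw [h1, Real.sqrt_sq (norm_nonneg _), frozenVec, norm_smul, norm_inv, Real.norm_eq_abs,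
    abs_of_pos (by linarith), div_eq_inv_mul]

lemma larRho_eq_rhoSeq [NeZero p] {K : ℕ} {y : EuclideanSpace ℝ (Fin n)} (hK : K < X.rank)
    (hy : Generic X y) (h : IrrepresentableCheck X (larPath X y K)) {k : ℕ} (hk : k ≤ K + 1) :
    larRho X y k = rhoSeq X (fun l => larIndex X y (l + 1)) k ∧ larRho X y k ≠ 0 := by
  rcases k with _ | k
  · exact ⟨rfl, one_ne_zero⟩
  have hi := path_independent hK hy h (k := k) (by omega)
  obtain ⟨h1, h2⟩ := path_step hK hy h (by omega) hi
  have h3 : larRho X y (k + 1) = ‖frozenVec X (larPath X y k) (larIndex X y (k + 1))‖ :=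
    hi.norm_frozenVec h1
  refine ⟨?_, ?_⟩
  · rw [h3, rhoSeq, direction, ← larPath_eq_pre]
  · rw [h3, norm_ne_zero_iff]
    exact frozenVec_ne_zero h2 h1

end Rho

/-! ### Conditional law of the knots along one path -/

section PathComputation

variable {n p : ℕ} {X : Matrix (Fin n) (Fin p) ℝ} {K : ℕ} {q : ℕ → Fin (p + p)}

variable (X K q) in
/-- The observations whose knots of index `a, …, a + g + 1` along the path `q` are
non-increasing. -/
def decreasingSet (a g : ℕ) : Set (EuclideanSpace ℝ (Fin n)) :=
  {y | ∀ k, a ≤ k → k ≤ a + g → knotSeq X y K q (k + 1) ≤ knotSeq X y K q k}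

lemma measurableSet_decreasingSet (a g : ℕ) : MeasurableSet (decreasingSet X K q a g) := by
  simp only [decreasingSet, Set.ofPred_forall]
  exact MeasurableSet.iInter fun k => MeasurableSet.iInter fun _ => MeasurableSet.iInter fun _ =>
    measurableSet_le (measurable_knotSeq _) (measurable_knotSeq _)

variable (X K q) in
/-- The pairs of an observation and of values of the knots of index `a + 1, …, a + g` which are
non-increasing along the path, the knot of index `k` being capped at `τ k`. -/
def decreasingPairs (τ : ℕ → EReal) (a g : ℕ) : Set (EuclideanSpace ℝ (Fin n) × (Fin g → ℝ)) :=
  {z | z.2 ∈ chainSet τ (knotSeq X z.1 K q (a + g + 1)) g a (knotSeq X z.1 K q a)}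

lemma measurableSet_decreasingPairs (τ : ℕ → EReal) (a g : ℕ) :
    MeasurableSet (decreasingPairs X K q τ a g) := by
  have h := measurableSet_chainSet_prod τ g a
  exact h.preimage ((((measurable_knotSeq (a + g + 1)).comp measurable_fst).prodMk
    ((measurable_knotSeq a).comp measurable_fst)).prodMk measurable_snd)

/-- The end knots, of index `a` and `a + g + 1`, are read off the projection, while the knots in
between are the removed coordinates. -/
lemma Regular.mem_decreasingPairs_iff (hq : Regular X K q) {a g : ℕ} (hg : 1 ≤ g)
    (hgK : a + g ≤ K) (τ : ℕ → EReal) (y : EuclideanSpace ℝ (Fin n)) :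
    (outerProj X q a g y, fun k : Fin g => ⟪direction X q (a + k), y⟫) ∈
        decreasingPairs X K q τ a g ↔
      y ∈ decreasingSet X K q a g ∧ ∀ k : Fin g, knotSeq X y K q (a + 1 + k) ≤ τ (a + 1 + k) := by
  have hv : ∀ k : Fin g, knotSeq X y K q (a + 1 + k) = (⟪direction X q (a + k), y⟫ : ℝ) := by
    intro k
    have hk : a + k < K := by omega
    rw [show a + 1 + (k : ℕ) = a + k + 1 by omega, knotSeq, if_pos hk, frozenZ_eq_inner, direction]
  rw [decreasingPairs, Set.mem_ofPred_eq, hq.knotSeq_outerProj hgK y (by omega),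
    hq.knotSeq_outerProj hgK y (by omega), mem_chainSet_iff hg hv]
  simp_rw [hv]
  rfl

/-- The conditional law of the knots of index `a + 1, …, a + g` along a regular path. -/
theorem Regular.setLIntegral_ratio (hq : Regular X K q) {a g : ℕ} (hg : 1 ≤ g)
    (hgK : a + g ≤ K) (β : EuclideanSpace ℝ (Fin n)) (hβ : β ∈ selectedSpan X (pre q a)) (σ : ℝ)
    (τ : ℕ → EReal) {C : Set (EuclideanSpace ℝ (Fin n))} (hC : MeasurableSet C)
    (hCP : ∀ y, outerProj X q a g y ∈ C ↔ y ∈ C) {f : EuclideanSpace ℝ (Fin n) → ℝ≥0∞}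
    (hfm : Measurable f)
    (hf : ∀ y ∈ C, f y =
      chainMass (knotLaw σ (rhoSeq X q)) τ (knotSeq X y K q (a + g + 1)) g a (knotSeq X y K q a) /
      chainMass (knotLaw σ (rhoSeq X q)) (fun _ => ⊤) (knotSeq X y K q (a + g + 1)) g a
        (knotSeq X y K q a)) :
    ∫⁻ y in decreasingSet X K q a g ∩ C, f y ∂(isoGaussian β σ)
      = isoGaussian β σ ({y | y ∈ decreasingSet X K q a g ∧
        ∀ k : Fin g, knotSeq X y K q (a + 1 + k) ≤ τ (a + 1 + k)} ∩ C) ∧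
    isoGaussian β σ (decreasingSet X K q a g ∩ {y | chainMass (knotLaw σ (rhoSeq X q)) (fun _ => ⊤)
      (knotSeq X y K q (a + g + 1)) g a (knotSeq X y K q a) = 0}) = 0 := by
  set P := outerProj X q a g with hP
  let V : EuclideanSpace ℝ (Fin n) → Fin g → ℝ := fun y k => ⟪direction X q (a + k), y⟫
  set π := Measure.pi fun k : Fin g => knotLaw σ (rhoSeq X q) (a + 1 + k) with hπ
  -- The mean lies in `H_a`, to which the directions of index at least `a` are orthogonal: this is
  -- where the null hypothesis centers the knots.
  have hlaw : (isoGaussian β σ).map (fun y => (P y, V y)) = ((isoGaussian β σ).map P).prod π := by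
    have h := map_projection_prod_coords β σ (fun k : Fin g => direction X q (a + k))
      (fun k l hkl => hq.inner_direction (by omega) (by omega) (by omega))
      (fun k => (Submodule.mem_orthogonal' _ _).1 (hq.direction_mem_orthogonal (by omega)) _
        (selectedSpan_pre_mono (by omega) hβ))
    refine h.trans ?_
    congr 2
    ext1 k
    rw [knotLaw, show a + 1 + (k : ℕ) = a + k + 1 by omega, rhoSeq]
  have hPm : Measurable P := P.continuous.measurable
  have hΦ : Measurable fun y => (P y, V y) :=
    hPm.prodMk (measurable_pi_lambda _ fun k => by fun_prop)
  have hprob : IsProbabilityMeasure ((isoGaussian β σ).map P) :=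
    Measure.isProbabilityMeasure_map hPm.aemeasurable
  have hsec : ∀ (τ' : ℕ → EReal) (w : EuclideanSpace ℝ (Fin n)),
      π (Prod.mk w ⁻¹' decreasingPairs X K q τ' a g) = chainMass (knotLaw σ (rhoSeq X q)) τ'
        (knotSeq X w K q (a + g + 1)) g a (knotSeq X w K q a) := fun τ' w =>
    pi_chainSet (knotLaw σ (rhoSeq X q)) τ' (knotSeq X w K q (a + g + 1)) g a (knotSeq X w K q a)
  have hk1 : ∀ y, knotSeq X (P y) K q (a + g + 1) = knotSeq X y K q (a + g + 1) := fun y =>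
    hq.knotSeq_outerProj hgK y (by omega)
  have hk2 : ∀ y, knotSeq X (P y) K q a = knotSeq X y K q a := fun y =>
    hq.knotSeq_outerProj hgK y (by omega)
  have hpre : ∀ (τ' : ℕ → EReal) y, (P y, V y) ∈ decreasingPairs X K q τ' a g ↔
      y ∈ decreasingSet X K q a g ∧ ∀ k : Fin g, knotSeq X y K q (a + 1 + k) ≤ τ' (a + 1 + k) :=
    fun τ' y => hq.mem_decreasingPairs_iff hg hgK τ' y
  have hS := measurableSet_decreasingPairs (X := X) (K := K) (q := q) (fun _ => ⊤) a g
  have hS' := measurableSet_decreasingPairs (X := X) (K := K) (q := q) τ a g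
  have hfm' : Measurable fun z : EuclideanSpace ℝ (Fin n) × (Fin g → ℝ) => f z.1 :=
    hfm.comp measurable_fst
  have hC' : MeasurableSet (Prod.fst ⁻¹' C : Set (EuclideanSpace ℝ (Fin n) × (Fin g → ℝ))) :=
    measurable_fst hC
  constructor
  · have hsub : decreasingPairs X K q τ a g ⊆ decreasingPairs X K q (fun _ => ⊤) a g :=
      fun z hz => chainSet_subset_top _ _ _ _ _ hz
    have key := setLIntegral_section_ratio ((isoGaussian β σ).map P) π hS hS' hsub hC hfm
      (fun w hw => by rw [hsec, hsec]; exact hf w hw)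
    rw [← hlaw, Measure.map_apply hΦ (hS'.inter hC'), setLIntegral_map (hS.inter hC')
      hfm' hΦ] at key
    have e1 : (fun y => (P y, V y)) ⁻¹' (decreasingPairs X K q (fun _ => ⊤) a g ∩ Prod.fst ⁻¹' C)
        = decreasingSet X K q a g ∩ C := by
      ext y
      simp only [Set.mem_preimage, Set.mem_inter_iff, hpre, le_top, implies_true, and_true, hCP]
    have e2 : (fun y => (P y, V y)) ⁻¹' (decreasingPairs X K q τ a g ∩ Prod.fst ⁻¹' C)
        = {y | y ∈ decreasingSet X K q a g ∧
          ∀ k : Fin g, knotSeq X y K q (a + 1 + k) ≤ τ (a + 1 + k)} ∩ C := by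
      ext y
      simp only [Set.mem_preimage, Set.mem_inter_iff, hpre, hCP]
      rfl
    rw [e1, e2] at key
    rw [← key]
    -- On the invariant set `C`, `f` depends on `y` only through the two end knots, so it takes the
    -- same value at `y` and at its projection.
    refine setLIntegral_congr_fun ((measurableSet_decreasingSet a g).inter hC) fun y hy => ?_
    show f y = f (P y)
    rw [hf y hy.2, hf (P y) ((hCP y).2 hy.2), hk1, hk2]
  · have key := measure_section_null ((isoGaussian β σ).map P) π hS
    have h0 : MeasurableSet (decreasingPairs X K q (fun _ => ⊤) a g ∩
        {z | π (Prod.mk z.1 ⁻¹' decreasingPairs X K q (fun _ => ⊤) a g) = 0}) :=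
      hS.inter (((measurable_measure_prodMk_left hS).comp measurable_fst) (measurableSet_singleton 0))
    rw [← hlaw, Measure.map_apply hΦ h0] at key
    refine measure_mono_null (fun y hy => ?_) key
    refine ⟨(hpre _ y).2 ⟨hy.1, fun _ => le_top⟩, ?_⟩
    show π (Prod.mk (P y) ⁻¹' decreasingPairs X K q (fun _ => ⊤) a g) = 0
    rw [hsec, hk1, hk2]
    exact hy.2

end PathComputation

/-! ### Extreme positions of the cap and of the end points -/

section ChainMass

variable (γ : ℕ → Measure ℝ)

lemma chainMass_eq_top_of_le {τ : ℕ → EReal} {lc la : EReal} {g a : ℕ} (h : ∀ k, la ≤ τ k) :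
    chainMass γ τ lc g a la = chainMass γ (fun _ => ⊤) lc g a la := by
  induction g generalizing a la with
  | zero => rfl
  | succ g ih =>
    have e : {y : ℝ | lc ≤ y ∧ (y : EReal) ≤ la ∧ (y : EReal) ≤ τ (a + 1)}
        = {y : ℝ | lc ≤ y ∧ (y : EReal) ≤ la ∧ (y : EReal) ≤ ⊤} := by
      ext y
      exact ⟨fun hy => ⟨hy.1, hy.2.1, le_top⟩, fun hy => ⟨hy.1, hy.2.1, hy.2.1.trans (h _)⟩⟩
    simp only [chainMass]
    rw [e]
    exact setLIntegral_congr_fun (measurableSet_cap _ _ _) fun y hy =>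
      ih fun k => hy.2.1.trans (h k)

lemma chainMass_eq_zero_of_lt {τ : ℕ → EReal} {lc la : EReal} {g a : ℕ} (hg : 1 ≤ g)
    (h : la < lc) : chainMass γ τ lc g a la = 0 := by
  obtain ⟨g, rfl⟩ : ∃ g', g = g' + 1 := ⟨g - 1, by omega⟩
  rw [chainMass]
  have e : {y : ℝ | lc ≤ y ∧ (y : EReal) ≤ la ∧ (y : EReal) ≤ τ (a + 1)} = ∅ :=
    Set.eq_empty_of_forall_notMem fun y hy => absurd (hy.1.trans hy.2.1) (not_le.2 h)
  rw [e, Measure.restrict_empty, lintegral_zero_measure]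

variable [∀ k, IsProbabilityMeasure (γ k)]

lemma chainMass_cap_eq_zero {lc la t : EReal} {g a b : ℕ} (hab : a < b) (hb : b ≤ a + g)
    (h : t < lc) : chainMass γ (fun k => if k = b then t else ⊤) lc g a la = 0 := by
  obtain ⟨h', rfl⟩ : ∃ h', b = a + h' + 1 := ⟨b - a - 1, by omega⟩
  obtain ⟨g', rfl⟩ : ∃ g', g = h' + 1 + g' := ⟨g - (h' + 1), by omega⟩
  rw [chainMass_split]
  have e : {x : ℝ | lc ≤ x ∧ (x : EReal) ≤ la ∧ (x : EReal) ≤ t} = ∅ :=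
    Set.eq_empty_of_forall_notMem fun y hy => absurd (hy.1.trans hy.2.2) (not_le.2 h)
  rw [e, Measure.restrict_empty, lintegral_zero_measure]

lemma chainMass_le_top (τ : ℕ → EReal) (lc la : EReal) (g a : ℕ) :
    chainMass γ τ lc g a la ≤ chainMass γ (fun _ => ⊤) lc g a la := by
  rw [← pi_chainSet, ← pi_chainSet]
  exact measure_mono (chainSet_subset_top τ lc g a la)

end ChainMass

/-! ### The ratio as a function of the conditioning data -/

section Data

variable {n p : ℕ} (X : Matrix (Fin n) (Fin p) ℝ)

/-- The sequence of signed variables which starts with `i` and is given by `κ` on `(a, d]`. -/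
def seqOf [NeZero p] {a d : ℕ} (i : Fin a → Fin (p + p)) (κ : Finset.Ioc a d → Fin (p + p))
    (l : ℕ) : Fin (p + p) :=
  if h : l < a then i ⟨l, h⟩ else if h' : l + 1 ∈ Finset.Ioc a d then κ ⟨l + 1, h'⟩
    else Fin.castAdd p 0

/-- The entries of `κ` are numbered from `1` and those of `q` from `0`, whence the shift. The
default value of `seqOf` is met only at positions at least `d`, which `l < k ≤ d` avoids. -/
lemma seqOf_eq [NeZero p] {a d : ℕ} {i : Fin a → Fin (p + p)} {κ : Finset.Ioc a d → Fin (p + p)}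
    {q : ℕ → Fin (p + p)} {k : ℕ} (hi : pre q a = i)
    (hκ : ∀ l : Finset.Ioc a d, (l : ℕ) ≤ k → κ l = q ((l : ℕ) - 1)) (hk : k ≤ d) {l : ℕ}
    (hl : l < k) : seqOf i κ l = q l := by
  rw [seqOf]
  split_ifs with h1 h2
  · rw [← hi]
  · exact hκ ⟨l + 1, h2⟩ hl
  · simp only [Finset.mem_Ioc] at h2
    omega

/-- The mass of the decreasing sequences between `λ_c` and `λ_a`, as a function of the data
`(λ_a, λ_c, (î_{a+1}, …, î_d))`. -/
def dataMass [NeZero p] (σ : ℝ) {a d : ℕ} (c : ℕ) (i : Fin a → Fin (p + p)) (τ : ℕ → EReal)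
    (z : EReal × EReal × (Finset.Ioc a d → Fin (p + p))) : ℝ≥0∞ :=
  chainMass (knotLaw σ (rhoSeq X (seqOf i z.2.2))) τ z.2.1 (c - 1 - a) a z.1

lemma measurable_dataMass [NeZero p] (σ : ℝ) {a d : ℕ} (c : ℕ) (i : Fin a → Fin (p + p))
    (τ : ℕ → EReal) : Measurable (dataMass X σ (d := d) c i τ) := by
  refine Measurable.apply_countable (g := fun z : EReal × EReal × (Finset.Ioc a d → Fin (p + p)) => z.2.2)
    (f := fun κ z => chainMass (knotLaw σ (rhoSeq X (seqOf i κ))) τ z.2.1 (c - 1 - a) a z.1)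
    (by fun_prop) fun κ => ?_
  exact (measurable_chainMass _ τ (c - 1 - a) a).comp (by fun_prop :
    Measurable fun z : EReal × EReal × (Finset.Ioc a d → Fin (p + p)) => (z.2.1, z.1))

/-- The conditional distribution function at `t` of `λ_b` given the data. -/
def dataRatio [NeZero p] (σ : ℝ) {a d : ℕ} (b c : ℕ) (i : Fin a → Fin (p + p)) (t : EReal)
    (z : EReal × EReal × (Finset.Ioc a d → Fin (p + p))) : ℝ≥0∞ :=
  dataMass X σ c i (fun k => if k = b then t else ⊤) z / dataMass X σ c i (fun _ => ⊤) z

lemma measurable_dataRatio [NeZero p] (σ : ℝ) {a d : ℕ} (b c : ℕ) (i : Fin a → Fin (p + p))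
    (t : EReal) : Measurable (dataRatio X σ (d := d) b c i t) :=
  (measurable_dataMass X σ c i _).div (measurable_dataMass X σ c i _)

lemma dataRatio_le_one [NeZero p] (σ : ℝ) {a d : ℕ} (b c : ℕ) (i : Fin a → Fin (p + p))
    (t : EReal) (z : EReal × EReal × (Finset.Ioc a d → Fin (p + p))) :
    dataRatio X σ b c i t z ≤ 1 :=
  ENNReal.div_le_of_le_mul (by rw [one_mul]; exact chainMass_le_top _ _ _ _ _ _)

/-- The data `(λ_a, λ_c, (î_{a+1}, …, î_d))` of an observation. -/
def knotData [NeZero p] (a c d : ℕ) (y : EuclideanSpace ℝ (Fin n)) :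
    EReal × EReal × (Finset.Ioc a d → Fin (p + p)) :=
  (larKnot X y a, larKnot X y c, fun l => larIndex X y l)

lemma measurable_knotData [NeZero p] (a c d : ℕ) : Measurable (knotData X a c d) :=
  (measurable_larKnot a).prodMk ((measurable_larKnot c).prodMk
    (measurable_pi_lambda _ fun l => measurable_larIndex l))

variable {X}

/-- The ratio of the `F_{abc}` is the conditional distribution function. -/
theorem Fabc_div_eq_dataRatio [NeZero p] {σ : ℝ} (hσ : σ ≠ 0) {K a b c d : ℕ} (hab : a < b)
    (hbc : b < c) (hcK : c ≤ K + 1) (hcd : c ≤ d + 1) (hK : K < X.rank)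
    {y : EuclideanSpace ℝ (Fin n)} (hy : Generic X y) (h : IrrepresentableCheck X (larPath X y K))
    {i : Fin a → Fin (p + p)} (hi : larPath X y a = i)
    (h0 : dataMass X σ c i (fun _ => ⊤) (knotData X a c d y) ≠ 0) (t : EReal) :
    0 < Fabc σ (larRho X y) a b c (larKnot X y a) (larKnot X y c) (larKnot X y a) ∧
    (if t ≤ larKnot X y a then
      Fabc σ (larRho X y) a b c (larKnot X y a) (larKnot X y c) t /
        Fabc σ (larRho X y) a b c (larKnot X y a) (larKnot X y c) (larKnot X y a)
      else 1) = (dataRatio X σ b c i t (knotData X a c d y)).toReal := by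
  have hρ : ∀ k, a ≤ k → k ≤ c → σ * larRho X y k ≠ 0 := fun k _ hk =>
    mul_ne_zero hσ (larRho_eq_rhoSeq hK hy h (by omega)).2
  -- Only the laws of index `a + 1, …, c - 1` enter, and `ρ_k` depends on the first `k` variables
  -- only; since `c - 1 ≤ d`, these variables are contained in `i` and the data.
  have hmass : ∀ τ, dataMass X σ c i τ (knotData X a c d y)
      = chainMass (knotLaw σ (larRho X y)) τ (larKnot X y c) (c - 1 - a) a (larKnot X y a) := by
    intro τ
    refine chainMass_congr (fun k h1 h2 => ?_) fun _ _ _ => rfl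
    rw [knotLaw, knotLaw, (larRho_eq_rhoSeq hK hy h (k := k) (by omega)).1]
    rw [larPath_eq_pre] at hi
    rw [rhoSeq_congr (fun l hl => seqOf_eq (k := k) hi (fun l _ => ?_) (by omega) hl)]
    have := (Finset.mem_Ioc.1 l.2).1
    show larIndex X y l = larIndex X y (l - 1 + 1)
    rw [Nat.sub_add_cancel (by omega)]
  rw [hmass] at h0
  -- A positive mass forces the end points to be in order, since at least one free term lies between
  -- them.
  have hle : larKnot X y c ≤ larKnot X y a := by
    by_contra hlt
    exact h0 (chainMass_eq_zero_of_lt _ (by omega) (not_le.1 hlt))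
  have htop : Fabc σ (larRho X y) a b c (larKnot X y a) (larKnot X y c) (larKnot X y a)
      = (chainMass (knotLaw σ (larRho X y)) (fun _ => ⊤) (larKnot X y c) (c - 1 - a) a
        (larKnot X y a)).toReal := by
    rw [Fabc_eq_chainMass hab hbc hρ hle le_rfl, chainMass_eq_top_of_le]
    intro k; split_ifs <;> simp
  have hfin : chainMass (knotLaw σ (larRho X y)) (fun _ => ⊤) (larKnot X y c) (c - 1 - a) a
        (larKnot X y a) ≠ ⊤ := ((chainMass_le_one _ _ _ _ _ _).trans_lt ENNReal.one_lt_top).ne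
  refine ⟨by rw [htop]; exact ENNReal.toReal_pos h0 hfin, ?_⟩
  rw [dataRatio, hmass, hmass, ENNReal.toReal_div, htop]
  split_ifs with hta
  · by_cases hct : larKnot X y c ≤ t
    · rw [Fabc_eq_chainMass hab hbc hρ hct hta]
    · rw [Fabc_eq_zero (fun h => hct h.1), chainMass_cap_eq_zero _ hab (by omega) (not_le.1 hct)]
      simp
  -- Above `λ_a` the cap is inactive, so that numerator and denominator agree.
  · rw [chainMass_eq_top_of_le, div_self]
    · exact (ENNReal.toReal_pos h0 hfin).ne'
    · intro k
      split_ifs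
      · exact (not_le.1 hta).le
      · exact le_top

end Data

/-! ### The selection event and the sum over paths -/

section Selection

variable {n p : ℕ} [NeZero p] (X : Matrix (Fin n) (Fin p) ℝ)

/-- The information on which a stopping rule relies at time `a`. -/
def stoppingData (K n₁ a : ℕ) (y : EuclideanSpace ℝ (Fin n)) :
    (Fin a → EReal) × (Fin (K + 1) → Fin (p + p)) × ℝ :=
  ((fun l : Fin a => larKnot X y (l + 1)), larPath X y (K + 1), sigmaSelect X K n₁ y)

lemma measurable_stoppingData (K n₁ a : ℕ) : Measurable (stoppingData X K n₁ a) :=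
  (measurable_pi_lambda _ fun _ => measurable_larKnot _).prodMk
    ((measurable_larPath _).prodMk (measurable_sigmaSelect n₁))

variable {X}

/-- The event `m̂ = a` is `m̂ ≤ a` without `m̂ ≤ a - 1`, and the information at time `a - 1` is a
function of that at time `a`. -/
lemma IsStoppingRule.exists_measurableSet {Ω : Type*} {K n₁ : ℕ}
    {Y : Ω → EuclideanSpace ℝ (Fin n)} {mhat : Ω → ℕ} (h : IsStoppingRule X K n₁ Y mhat) {a : ℕ}
    (ha : a < K) : ∃ B, MeasurableSet B ∧ ∀ ω, mhat ω = a ↔ stoppingData X K n₁ a (Y ω) ∈ B := by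
  have key : ∀ a' < K, ∃ B, MeasurableSet B ∧
      ∀ ω, mhat ω ≤ a' ↔ stoppingData X K n₁ a' (Y ω) ∈ B := by
    intro a' ha'
    obtain ⟨B, hB, hB'⟩ := h.2 a' ha'
    exact ⟨B, hB, fun ω => (Set.ext_iff.1 hB' ω).symm⟩
  obtain ⟨B, hB, hBa⟩ := key a ha
  rcases a with _ | a
  · exact ⟨B, hB, fun ω => by rw [← hBa, Nat.le_zero]⟩
  obtain ⟨B', hB', hBa'⟩ := key a (by omega)
  let r : (Fin (a + 1) → EReal) × (Fin (K + 1) → Fin (p + p)) × ℝ →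
      (Fin a → EReal) × (Fin (K + 1) → Fin (p + p)) × ℝ := fun z => (fun l => z.1 l.castSucc, z.2)
  have hr : Measurable r := (measurable_pi_lambda _ fun _ =>
    (measurable_pi_apply _).comp measurable_fst).prodMk measurable_snd
  refine ⟨B \ r ⁻¹' B', hB.diff (hr hB'), fun ω => ?_⟩
  have h1 : r (stoppingData X K n₁ (a + 1) (Y ω)) = stoppingData X K n₁ a (Y ω) := rfl
  rw [Set.mem_sdiff, Set.mem_preimage, h1, ← hBa, ← hBa']
  omega

variable (X) in
/-- The selection event, as a set of observations. -/
def selectionSet (K n₁ : ℕ) {a : ℕ} (i : Fin a → Fin (p + p))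
    (B : Set ((Fin a → EReal) × (Fin (K + 1) → Fin (p + p)) × ℝ)) :
    Set (EuclideanSpace ℝ (Fin n)) :=
  {y | stoppingData X K n₁ a y ∈ B ∧ larPath X y a = i ∧ IrrepresentableCheck X (larPath X y K)}

lemma measurableSet_selectionSet (K n₁ : ℕ) {a : ℕ} (i : Fin a → Fin (p + p))
    {B : Set ((Fin a → EReal) × (Fin (K + 1) → Fin (p + p)) × ℝ)} (hB : MeasurableSet B) :
    MeasurableSet (selectionSet X K n₁ i B) :=
  (measurable_stoppingData X K n₁ a hB).inter
    (((measurable_larPath a) (measurableSet_singleton i)).inter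
      ((measurable_larPath K) (Set.to_countable {j | IrrepresentableCheck X j}).measurableSet))

/-- The conditional law of `λ_b` on the part of the selection event where the first `K` signed
variables are `j`. -/
lemma setLIntegral_dataRatio_path {σ : ℝ} (hσ : σ ≠ 0) {K n₁ a b c d : ℕ} (hab : a < b)
    (hbc : b < c) (hcK : c ≤ K + 1) (hcd : c ≤ d + 1) (hdK : d ≤ K + 1) (hK : K < X.rank)
    (β : EuclideanSpace ℝ (Fin n)) {i : Fin a → Fin (p + p)} (hβ : β ∈ selectedSpan X i)
    {B : Set ((Fin a → EReal) × (Fin (K + 1) → Fin (p + p)) × ℝ)} (hB : MeasurableSet B)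
    {T : Set (EReal × EReal × (Finset.Ioc a d → Fin (p + p)))} (hT : MeasurableSet T) (t : EReal)
    (j : Fin K → Fin (p + p)) :
    ∫⁻ y in selectionSet X K n₁ i B ∩ knotData X a c d ⁻¹' T ∩ {y | larPath X y K = j},
        dataRatio X σ b c i t (knotData X a c d y) ∂(isoGaussian β σ)
      = isoGaussian β σ (selectionSet X K n₁ i B ∩ knotData X a c d ⁻¹' T ∩
          {y | larPath X y K = j} ∩ {y | larKnot X y b ≤ t}) ∧
    ∀ᵐ y ∂(isoGaussian β σ), y ∈ selectionSet X K n₁ i B → larPath X y K = j →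
      dataMass X σ c i (fun _ => ⊤) (knotData X a c d y) ≠ 0 := by
  have hgen := ae_generic β X hσ
  obtain ⟨g, rfl⟩ : ∃ g, c = a + g + 1 := ⟨c - 1 - a, by omega⟩
  have hg : 1 ≤ g := by omega
  have hgK : a + g ≤ K := by omega
  let q : ℕ → Fin (p + p) := fun l => if h : l < K then j ⟨l, h⟩ else Fin.castAdd p 0
  have hqj : pre q K = j := by ext1 l; simp [pre, q]
  by_cases hgood : Regular X K q ∧ pre q a = i ∧ IrrepresentableCheck X j
  swap
  -- If `j` is not regular, fails the check or does not extend `i`, generic observations of the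
  -- selection event never follow it, and both claims are void.
  · have hnull : ∀ᵐ y ∂(isoGaussian β σ), y ∈ selectionSet X K n₁ i B → larPath X y K ≠ j := by
      filter_upwards [hgen] with y hy hyS hyj
      have hirr : IrrepresentableCheck X (pre q K) := by rw [hqj, ← hyj]; exact hyS.2.2
      refine hgood ⟨⟨hK, hirr.theta_lt, ?_⟩, ?_, hqj ▸ hirr⟩
      · rw [hqj, ← hyj]
        exact path_independent hK hy hyS.2.2 (by omega)
      · rw [← hyS.2.1, larPath_eq_pre_iff.2]
        intro l hl
        exact larPath_eq_pre_iff.1 (hyj.trans hqj.symm) l (by omega)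
    refine ⟨?_, by filter_upwards [hnull] with y hy h1 h2 using absurd h2 (hy h1)⟩
    have h0 : isoGaussian β σ (selectionSet X K n₁ i B ∩ knotData X a (a + g + 1) d ⁻¹' T ∩
        {y | larPath X y K = j}) = 0 := by
      rw [measure_eq_zero_iff_ae_notMem]
      filter_upwards [hnull] with y hy hy'
      exact hy hy'.1.1 hy'.2
    rw [setLIntegral_measure_zero _ _ h0, measure_mono_null Set.inter_subset_left h0]
  obtain ⟨hq, hqa, hirr⟩ := hgood
  -- `D` and `S` are the conditioning data and the stopping data computed along the fixed path `q`.
  -- They agree with the true ones when the path is followed, and unlike those they can be compared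
  -- at `y` and at its projection.
  let D : EuclideanSpace ℝ (Fin n) → EReal × EReal × (Finset.Ioc a d → Fin (p + p)) := fun y =>
    (knotSeq X y K q a, knotSeq X y K q (a + g + 1), fun l => indexSeq X y K q (l - 1))
  let S : EuclideanSpace ℝ (Fin n) → (Fin a → EReal) × (Fin (K + 1) → Fin (p + p)) × ℝ := fun y =>
    ((fun l : Fin a => knotSeq X y K q (l + 1)), pre (indexSeq X y K q) (K + 1), sigmaSeq X K q n₁ y)
  have hDm : Measurable D := (measurable_knotSeq _).prodMk ((measurable_knotSeq _).prodMk
    (measurable_pi_lambda _ fun l => measurable_indexSeq _))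
  have hSm : Measurable S := (measurable_pi_lambda _ fun l => measurable_knotSeq _).prodMk
    ((measurable_pre_indexSeq _).prodMk (measurable_sigmaSeq n₁))
  -- The monotonicity conditions that do not involve the removed knots; the others form
  -- `decreasingSet`.
  let O : Set (EuclideanSpace ℝ (Fin n)) :=
    {y | ∀ k ≤ K, (k < a ∨ a + g < k) → knotSeq X y K q (k + 1) ≤ knotSeq X y K q k}
  have hOm : MeasurableSet O := by
    simp only [O, Set.ofPred_forall]
    exact MeasurableSet.iInter fun k => MeasurableSet.iInter fun _ => MeasurableSet.iInter fun _ =>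
      measurableSet_le (measurable_knotSeq _) (measurable_knotSeq _)
  let C : Set (EuclideanSpace ℝ (Fin n)) := S ⁻¹' B ∩ O ∩ D ⁻¹' T
  have hCm : MeasurableSet C := ((hSm hB).inter hOm).inter (hDm hT)
  have hDS : ∀ y, larPath X y K = j → knotData X a (a + g + 1) d y = D y ∧
      stoppingData X K n₁ a y = S y := by
    intro y hy
    rw [← hqj] at hy
    constructor
    · refine Prod.ext (hq.larKnot_eq_knotSeq hy (k := a) (by omega))
        (Prod.ext (hq.larKnot_eq_knotSeq hy (k := a + g + 1) (by omega)) ?_)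
      ext1 l
      have hl := Finset.mem_Ioc.1 l.2
      have := larIndex_eq_indexSeq hy (l := (l : ℕ) - 1) (by omega)
      rwa [Nat.sub_add_cancel (by omega)] at this
    · refine Prod.ext ?_ (Prod.ext (larPath_succ_eq hy) (sigmaSelect_eq_sigmaSeq hy n₁))
      ext1 l
      exact hq.larKnot_eq_knotSeq hy (k := l + 1) (by omega)
  have hmem : ∀ y, Generic X y →
      (y ∈ selectionSet X K n₁ i B ∩ knotData X a (a + g + 1) d ⁻¹' T ∩ {y | larPath X y K = j} ↔
        y ∈ decreasingSet X K q a g ∩ C) := by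
    intro y hy
    have hiff := hq.larPath_eq_iff hy
    rw [hqj] at hiff
    constructor
    · rintro ⟨⟨hsel, hdata⟩, hpath⟩
      obtain ⟨h1, h2⟩ := hDS y hpath
      have h3 := hiff.1 hpath
      refine ⟨fun k _ hk => h3 k (by omega), ⟨?_, fun k hk _ => h3 k hk⟩, ?_⟩
      · show S y ∈ B
        rw [← h2]; exact hsel.1
      · show D y ∈ T
        rw [← h1]; exact hdata
    · rintro ⟨hdec, ⟨h1, h2⟩, h3⟩
      have hpath : larPath X y K = j := by
        rw [hiff]
        intro k hk
        by_cases hka : a ≤ k ∧ k ≤ a + g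
        · exact hdec k hka.1 hka.2
        · exact h2 k hk (by omega)
      obtain ⟨h4, h5⟩ := hDS y hpath
      refine ⟨⟨⟨?_, ?_, ?_⟩, ?_⟩, hpath⟩
      · rw [h5]; exact h1
      · rw [← hqa]
        refine larPath_eq_pre_iff.2 fun l hl => larPath_eq_pre_iff.1 (hpath.trans hqj.symm) l (by omega)
      · rw [hpath]; exact hirr
      · show knotData X a (a + g + 1) d y ∈ T
        rw [h4]; exact h3
  -- Every ingredient of `C` uses only knots of index at most `a` or at least `c`, the variables,
  -- and the estimator, none of which the projection changes.
  have hCP : ∀ y, outerProj X q a g y ∈ C ↔ y ∈ C := by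
    intro y
    have h1 : S (outerProj X q a g y) = S y := by
      refine Prod.ext ?_ (Prod.ext ?_ (hq.sigmaSeq_outerProj hgK n₁ y))
      · ext1 l
        exact hq.knotSeq_outerProj hgK y (k := l + 1) (by omega)
      · show pre (indexSeq X _ K q) (K + 1) = pre (indexSeq X y K q) (K + 1)
        rw [hq.indexSeq_outerProj hgK]
    have h2 : D (outerProj X q a g y) = D y := by
      refine Prod.ext (hq.knotSeq_outerProj hgK y (k := a) (by omega))
        (Prod.ext (hq.knotSeq_outerProj hgK y (k := a + g + 1) (by omega)) ?_)
      ext1 l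
      show indexSeq X _ K q _ = indexSeq X y K q _
      rw [hq.indexSeq_outerProj hgK]
    have h3 : outerProj X q a g y ∈ O ↔ y ∈ O := by
      refine forall_congr' fun k => imp_congr_right fun hk => imp_congr_right fun hka => ?_
      rw [hq.knotSeq_outerProj hgK y (by omega), hq.knotSeq_outerProj hgK y (by omega)]
    show (S (outerProj X q a g y) ∈ B ∧ _) ∧ D (outerProj X q a g y) ∈ T ↔ _
    rw [h1, h2, h3]
    rfl
  have hmass : ∀ (τ : ℕ → EReal) y, dataMass X σ (a + g + 1) i τ (D y)
      = chainMass (knotLaw σ (rhoSeq X q)) τ (knotSeq X y K q (a + g + 1)) g a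
        (knotSeq X y K q a) := by
    intro τ y
    rw [dataMass, show a + g + 1 - 1 - a = g by omega]
    refine chainMass_congr (fun k h1 h2 => ?_) fun _ _ _ => rfl
    rw [knotLaw, knotLaw, rhoSeq_congr fun l hl => seqOf_eq (k := k) hqa (fun l hlk => ?_) (by omega) hl]
    have := (Finset.mem_Ioc.1 l.2).1
    show indexSeq X y K q (l - 1) = _
    rw [indexSeq, if_pos (by omega)]
  set τ : ℕ → EReal := fun k => if k = b then t else ⊤ with hτ
  obtain ⟨key, keynull⟩ := hq.setLIntegral_ratio hg hgK β (hqa ▸ hβ) σ τ hCm hCP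
    (f := fun y => dataRatio X σ b (a + g + 1) i t (D y))
    ((measurable_dataRatio X σ b (a + g + 1) i t).comp hDm)
    (fun y _ => by rw [dataRatio, hmass, hmass])
  have hset : (selectionSet X K n₁ i B ∩ knotData X a (a + g + 1) d ⁻¹' T ∩ {y | larPath X y K = j} :
      Set (EuclideanSpace ℝ (Fin n))) =ᵐ[isoGaussian β σ] (decreasingSet X K q a g ∩ C : Set _) := by
    filter_upwards [hgen] with y hy
    exact propext (hmem y hy)
  have hcap : ∀ y, (∀ k : Fin g, knotSeq X y K q (a + 1 + k) ≤ τ (a + 1 + k)) ↔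
      knotSeq X y K q b ≤ t := by
    intro y
    constructor
    · intro h
      -- The knot of index `b` is the free term at position `b - a - 1`; the cap is infinite at all
      -- other positions.
      have := h ⟨b - a - 1, by omega⟩
      rw [show a + 1 + (b - a - 1) = b by omega] at this
      simpa [hτ] using this
    · intro h k
      simp only [hτ]
      split_ifs with hk
      · rw [hk]; exact h
      · exact le_top
  constructor
  · have hms : MeasurableSet (selectionSet X K n₁ i B ∩ knotData X a (a + g + 1) d ⁻¹' T ∩
        {y | larPath X y K = j}) :=
      ((measurableSet_selectionSet K n₁ i hB).inter (measurable_knotData X _ _ _ hT)).inter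
        ((measurable_larPath K) (measurableSet_singleton j))
    rw [setLIntegral_congr_fun hms (g := fun y => dataRatio X σ b (a + g + 1) i t (D y))
      fun y hy => by rw [(hDS y hy.2).1], setLIntegral_congr hset, key]
    refine measure_congr ?_
    filter_upwards [hgen] with y hy
    refine propext ?_
    have h1 := hmem y hy
    constructor
    · rintro ⟨⟨h2, h3⟩, h4⟩
      have h5 := h1.2 ⟨h2, h4⟩
      refine ⟨h5, ?_⟩
      show larKnot X y b ≤ t
      rw [hq.larKnot_eq_knotSeq (hqj ▸ h5.2) (by omega)]
      exact (hcap y).1 h3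
    · rintro ⟨h2, h3⟩
      have h5 := h1.1 h2
      refine ⟨⟨h5.1, (hcap y).2 ?_⟩, h5.2⟩
      rw [← hq.larKnot_eq_knotSeq (hqj ▸ h2.2) (by omega)]
      exact h3
  · rw [measure_eq_zero_iff_ae_notMem] at keynull
    filter_upwards [hgen, keynull] with y hy hy0 hsel hpath h0
    rw [(hDS y hpath).1, hmass] at h0
    refine hy0 ⟨fun k _ hk => ?_, h0⟩
    have hiff := hq.larPath_eq_iff hy
    exact hiff.1 (hpath.trans hqj.symm) k (by omega)

/-- The conditional law of `λ_b` on the selection event. -/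
theorem setLIntegral_dataRatio {σ : ℝ} (hσ : σ ≠ 0) {K n₁ a b c d : ℕ} (hab : a < b)
    (hbc : b < c) (hcK : c ≤ K + 1) (hcd : c ≤ d + 1) (hdK : d ≤ K + 1) (hK : K < X.rank)
    (β : EuclideanSpace ℝ (Fin n)) {i : Fin a → Fin (p + p)} (hβ : β ∈ selectedSpan X i)
    {B : Set ((Fin a → EReal) × (Fin (K + 1) → Fin (p + p)) × ℝ)} (hB : MeasurableSet B)
    {T : Set (EReal × EReal × (Finset.Ioc a d → Fin (p + p)))} (hT : MeasurableSet T) (t : EReal) :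
    ∫⁻ y in selectionSet X K n₁ i B ∩ knotData X a c d ⁻¹' T,
        dataRatio X σ b c i t (knotData X a c d y) ∂(isoGaussian β σ)
      = isoGaussian β σ (selectionSet X K n₁ i B ∩ knotData X a c d ⁻¹' T ∩
          {y | larKnot X y b ≤ t}) := by
  set A := selectionSet X K n₁ i B ∩ knotData X a c d ⁻¹' T with hA
  have hAm : MeasurableSet A :=
    (measurableSet_selectionSet K n₁ i hB).inter (measurable_knotData X _ _ _ hT)
  have hjm : ∀ j : Fin K → Fin (p + p), MeasurableSet {y | larPath X y K = j} := fun j =>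
    (measurable_larPath K) (measurableSet_singleton j)
  have hbm : MeasurableSet {y | larKnot X y b ≤ t} :=
    measurableSet_le (measurable_larKnot b) measurable_const
  -- The integrand is one and the same function of the data on every path, so the identities for the
  -- separate paths add up.
  have e1 : A = ⋃ j, A ∩ {y | larPath X y K = j} := by
    ext y; simp
  have e2 : A ∩ {y | larKnot X y b ≤ t} = ⋃ j, A ∩ {y | larPath X y K = j} ∩ {y | larKnot X y b ≤ t} := by
    ext y; simp
  have hdisj : Pairwise (Function.onFun Disjoint fun j => A ∩ {y | larPath X y K = j}) := by
    intro j j' hjj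
    rw [Function.onFun, Set.disjoint_left]
    exact fun y hy hy' => hjj (hy.2.symm.trans hy'.2)
  rw [e2, measure_iUnion (fun j j' hjj => (hdisj hjj).mono Set.inter_subset_left Set.inter_subset_left)
    (fun j => (hAm.inter (hjm j)).inter hbm)]
  conv_lhs => rw [e1]
  rw [lintegral_iUnion (fun j => hAm.inter (hjm j)) hdisj]
  exact tsum_congr fun j =>
    (setLIntegral_dataRatio_path hσ hab hbc hcK hcd hdK hK β hβ hB hT t j).1

end Selection

end

end LAR

/-! ### The conditional distribution of `λ_b` -/

theorem mainTheorem9 {Ω : Type*} [MeasurableSpace Ω] (μ : Measure Ω) [IsProbabilityMeasure μ]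
    {n p : ℕ} [NeZero p] (X : Matrix (Fin n) (Fin p) ℝ) (β₀ : Fin p → ℝ) (σ : ℝ) (hσ : 0 < σ)
    (Y : Ω → EuclideanSpace ℝ (Fin n)) (hY : Measurable Y)
    (hlaw : μ.map Y = multivariateGaussian (WithLp.toLp 2 (X *ᵥ β₀))
      (σ ^ 2 • (1 : Matrix (Fin n) (Fin n) ℝ)))
    (K n₁ n₂ : ℕ) (hK : 1 ≤ K) (hKn : K + 3 < n) (hKr : K < X.rank)
    (hn : n = n₁ + n₂ + (K + 1))
    (mhat : Ω → ℕ) (hmhat : LAR.IsStoppingRule X K n₁ Y mhat)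
    (a b c : ℕ) (hab : a < b) (hbc : b < c) (hcK : c ≤ K + 1)
    -- the value of `(î₁, …, î_a)`, for which the null hypothesis reads `X β₀ ∈ H_a`
    (i : Fin a → Fin (p + p)) (hH0 : WithLp.toLp 2 (X *ᵥ β₀) ∈ LAR.selectedSpan X i)
    (E : Set Ω)
    (hE : E = {ω | mhat ω = a ∧ LAR.larPath X (Y ω) a = i ∧
      LAR.IrrepresentableCheck X (LAR.larPath X (Y ω) K)})
    -- `d = c - 1` is the conditioning on `λ_a, λ_c, î_{a+1}, …, î_{c-1}`
    (d : ℕ) (hcd : c ≤ d + 1) (hdK : d ≤ K + 1)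
    (t : ℝ) :
    ∀ᵐ ω ∂(μ[|E]),
      0 < LAR.Fabc σ (LAR.larRho X (Y ω)) a b c (LAR.larKnot X (Y ω) a) (LAR.larKnot X (Y ω) c)
          (LAR.larKnot X (Y ω) a) ∧
      ((μ[|E])⟦{ω' | LAR.larKnot X (Y ω') b ≤ (t : EReal)} | LAR.knotSigma X Y a c d⟧) ω =
        if (t : EReal) ≤ LAR.larKnot X (Y ω) a then
          LAR.Fabc σ (LAR.larRho X (Y ω)) a b c (LAR.larKnot X (Y ω) a) (LAR.larKnot X (Y ω) c) t /
            LAR.Fabc σ (LAR.larRho X (Y ω)) a b c (LAR.larKnot X (Y ω) a) (LAR.larKnot X (Y ω) c)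
              (LAR.larKnot X (Y ω) a)
        else 1 := by

  have ha : a < K := by omega
  have hlaw' : μ.map Y = LAR.isoGaussian (WithLp.toLp 2 (X *ᵥ β₀)) σ := hlaw
  obtain ⟨B, hB, hBa⟩ := hmhat.exists_measurableSet ha
  have hgen : ∀ᵐ ω ∂μ, LAR.Generic X (Y ω) :=
    ae_of_ae_map hY.aemeasurable (hlaw' ▸ LAR.ae_generic _ X hσ.ne')
  have hEY : E = Y ⁻¹' LAR.selectionSet X K n₁ i B := by
    rw [hE]
    ext ω
    exact and_congr_left fun _ => hBa ω
  have hEm : MeasurableSet E := hEY ▸ hY (LAR.measurableSet_selectionSet K n₁ i hB)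
  have hpos : ∀ᵐ ω ∂μ, ω ∈ E →
      LAR.dataMass X σ c i (fun _ => ⊤) (LAR.knotData X a c d (Y ω)) ≠ 0 := by
    have h : ∀ᵐ y ∂(LAR.isoGaussian (WithLp.toLp 2 (X *ᵥ β₀)) σ), ∀ j,
        y ∈ LAR.selectionSet X K n₁ i B → LAR.larPath X y K = j →
          LAR.dataMass X σ c i (fun _ => ⊤) (LAR.knotData X a c d y) ≠ 0 :=
      ae_all_iff.2 fun j => (LAR.setLIntegral_dataRatio_path hσ.ne' hab hbc hcK hcd hdK hKr _ hH0 hB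
        (T := Set.univ) MeasurableSet.univ t j).2
    rw [← hlaw'] at h
    filter_upwards [ae_of_ae_map hY.aemeasurable h] with ω hω hωE
    rw [hEY] at hωE
    exact hω _ hωE rfl
  have hDm : Measurable fun ω => LAR.knotData X a c d (Y ω) :=
    (LAR.measurable_knotData X a c d).comp hY
  have hm : LAR.knotSigma X Y a c d ≤ (inferInstance : MeasurableSpace Ω) := hDm.comap_le
  have hAm : MeasurableSet {ω | LAR.larKnot X (Y ω) b ≤ (t : EReal)} :=
    measurableSet_le ((LAR.measurable_larKnot b).comp hY) measurable_const
  let r : Ω → ENNReal := fun ω => LAR.dataRatio X σ b c i t (LAR.knotData X a c d (Y ω))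
  have hrm : Measurable r := (LAR.measurable_dataRatio X σ b c i t).comp hDm
  have hr1 : ∀ ω, r ω ≤ 1 := fun ω => LAR.dataRatio_le_one X σ b c i t _
  have hrlt : ∀ ω, r ω < ⊤ := fun ω => (hr1 ω).trans_lt ENNReal.one_lt_top
  -- Defining property of the conditional expectation: the ratio is a measurable function of the
  -- data and has the right integral over each event determined by the data.
  have hcond : (fun ω => (r ω).toReal) =ᵐ[μ[|E]]
      (μ[|E])⟦{ω' | LAR.larKnot X (Y ω') b ≤ (t : EReal)} | LAR.knotSigma X Y a c d⟧ := by
    have hint : Integrable (fun ω => (r ω).toReal) (μ[|E]) := by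
      refine Integrable.of_bound hrm.ennreal_toReal.aestronglyMeasurable 1
        (Filter.Eventually.of_forall fun ω => ?_)
      rw [Real.norm_of_nonneg ENNReal.toReal_nonneg]
      exact ENNReal.toReal_le_of_le_ofReal zero_le_one (by simpa using hr1 ω)
    refine ae_eq_condExp_of_forall_setIntegral_eq hm ((integrable_const (1 : ℝ)).indicator hAm)
      (fun s _ _ => hint.integrableOn) ?_ ?_
    · rintro s ⟨T, hT, rfl⟩ -
      have hs : MeasurableSet ((fun ω => LAR.knotData X a c d (Y ω)) ⁻¹' T) := hDm hT
      have key := LAR.setLIntegral_dataRatio (n₁ := n₁) hσ.ne' hab hbc hcK hcd hdK hKr _ hH0 hB hT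
        (t : EReal)
      have hsel : MeasurableSet (LAR.selectionSet X K n₁ i B ∩ LAR.knotData X a c d ⁻¹' T) :=
        (LAR.measurableSet_selectionSet K n₁ i hB).inter (LAR.measurable_knotData X a c d hT)
      have hbm : MeasurableSet {y | LAR.larKnot X y b ≤ (t : EReal)} :=
        measurableSet_le (LAR.measurable_larKnot b) measurable_const
      have hratio : Measurable fun y => LAR.dataRatio X σ b c i t (LAR.knotData X a c d y) :=
        (LAR.measurable_dataRatio X σ b c i t).comp (LAR.measurable_knotData X a c d)
      rw [← hlaw', setLIntegral_map hsel hratio hY, Measure.map_apply hY (hsel.inter hbm)] at key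
      have e : Y ⁻¹' (LAR.selectionSet X K n₁ i B ∩ LAR.knotData X a c d ⁻¹' T)
          = (fun ω => LAR.knotData X a c d (Y ω)) ⁻¹' T ∩ E := by
        rw [hEY, Set.inter_comm]; rfl
      rw [Set.preimage_inter (t := {y | LAR.larKnot X y b ≤ (t : EReal)}), e] at key
      show ∫ ω in (fun ω => LAR.knotData X a c d (Y ω)) ⁻¹' T, _ ∂_ =
        ∫ ω in (fun ω => LAR.knotData X a c d (Y ω)) ⁻¹' T, _ ∂_
      rw [integral_toReal hrm.aemeasurable (Filter.Eventually.of_forall hrlt),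
        setIntegral_indicator hAm, setIntegral_const, smul_eq_mul, mul_one, measureReal_def]
      congr 1
      -- Both sides carry the normalization `(μ E)⁻¹`; stripping it leaves the identity transported
      -- from the law of `Y`.
      rw [ProbabilityTheory.cond, Measure.restrict_smul, lintegral_smul_measure,
        Measure.restrict_restrict hs, Measure.smul_apply, Measure.restrict_apply (hs.inter hAm)]
      congr 1
      refine key.trans (congrArg μ ?_)
      ext ω
      simp only [Set.mem_inter_iff, Set.mem_preimage]
      exact and_right_comm
    · refine StronglyMeasurable.aestronglyMeasurable (Measurable.stronglyMeasurable ?_)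
      exact ((LAR.measurable_dataRatio X σ b c i t).comp (comap_measurable _)).ennreal_toReal
  have hE' : ∀ᵐ ω ∂(μ[|E]), ω ∈ E := ae_cond_mem hEm
  have hac : μ[|E] ≪ μ := cond_absolutelyContinuous
  filter_upwards [hcond, hE', hac.ae_le hgen, hac.ae_le hpos] with ω h1 h2 h3 h4
  have h5 := h2
  rw [hE] at h5
  obtain ⟨h6, h7⟩ := LAR.Fabc_div_eq_dataRatio hσ.ne' hab hbc hcK hcd hKr h3 h5.2.2 h5.2.1 (h4 h2) t
  exact ⟨h6, h1.symm.trans h7.symm⟩
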